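/- Conventions. A quantum circuit $C$ with input register $I$ and output register $O$ adjoins finitely many ancilla qubits in state $|0\rangle$, applies a list of gates from $\{H,T,\mathrm{CNOT}\}$, outputs designated qubits and discards the rest; its size is its number of qubits plus its number of gates. QPT algorithms and adversaries are families $(C_\lambda)_\lambda$ of such circuits of size at most polynomial in $\lambda$. A function is polynomially bounded if it is at most some polynomial, and $f$ is negligible if $\lambda^c f(\lambda)\to 0$ for all $c$. Logarithms are to base 2, and $\log 0$ is read as $0$. PRFS generators. A QPT family $G_\lambda$, which takes a key in $\{0,1\}^\lambda$ and an input in $\{0,1\}^{d(\lambda)}$ and outputs a (possibly mixed) state of $n(\lambda)$ qubits, is a selectively secure pseudorandom function-like state (PRFS) generator if for all polynomially bounded $s,t$, every QPT distinguisher $\mathcal A$ and every family of distinct $x_1,\dots,x_{s(\lambda)}\in\{0,1\}^{d(\lambda)}$, the quantity $$\Big|\Pr_{k\leftarrow\{0,1\}^\lambda}\big[\mathcal A(\{x_i,G_\lambda(k,x_i)^{\otimes t}\}_{i\le s})=1\big]-\Pr_{\psi_1,\dots,\psi_s\leftarrow\mu_n}\big[\mathcal A(\{x_i,|\psi_i\rangle^{\otimes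 t}\}_{i\le s})=1\big]\Big|$$ is negligible, where $\mu_n$ is the Haar measure on pure $n$-qubit states. Construction. Let $\lambda$ be the security parameter and $q$ the query bound, and let $G_{\lambda,q}$ be a family of circuits with key length $\lambda$, input length $d(\lambda,q)$ and output length $n(\lambda)$. A key consists of uniform $k_1,\dots,k_\lambda\in\{0,1\}^\lambda$. To encrypt a bit $m$, sample $s_1,\dots,s_\lambda\in\{0,1\}$ uniformly subject to $s_1\oplus\cdots\oplus s_\lambda=m$, sample tags $r_1,\dots,r_\lambda\in\{0,1\}^{d-1}$ uniformly, and output $(r_i,\,G_{\lambda,q}(k_i,(r_i,s_i)))_{i\le\lambda}$. To decrypt, apply a test circuit $\mathsf{Test}(k_i,(r_i,0),\cdot)$ to the $i$-th state, set $s_i=0$ if it accepts and $s_i=1$ otherwise, and output $s_1\oplus\cdots\oplus s_\lambda$. ($\mathsf{Test}$ may be any circuit family; it plays no role in the claims below.) CPA security for $q$ queries. With challenge bit $b$ and a random key, a QPT adversary adaptively makes at most $q(\lambda)$ queries $(m_0,m_1)$, each answered by a fresh encryption of $m_b$, and outputs a bit $b'$; security means that $|\Pr[b'=1\mid b=0]-\Pr[b'=1\mid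 b=1]|$ is negligible for every such adversary. Theorem. (i) Let $q=q(\lambda)$ be polynomially bounded. Suppose $d(\lambda,q(\lambda))\ge 2\log q(\lambda)+1$ for all $\lambda$ and the family $\lambda\mapsto G_{\lambda,q(\lambda)}$ is a selectively secure PRFS generator. Then the construction is CPA-secure for $q$ queries. (ii) The bit length of a key is bounded by a polynomial in $\lambda$, for all $\lambda$ and $q$. If $n(\lambda)$ is bounded by a polynomial in $\lambda$ and $d(\lambda,q)$ by a polynomial in $\lambda$ and $\lceil\log q\rceil$, then the number of qubits of a ciphertext (classical bits counted as qubits) is bounded, for all $\lambda$ and $q$, by a polynomial in $\lambda$ and $\lceil\log q\rceil$. In particular this holds for $n$ polynomially bounded and the least admissible input length $d(\lambda,q)=\lceil 2\log q\rceil+1$. -/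

import Mathlib

open MeasureTheory Filter
open scoped Matrix

noncomputable section

/-! ### Asymptotics -/

/-- `f` is bounded by a polynomial. -/
def PolyBounded (f : ℕ → ℕ) : Prop :=
  ∃ p : Polynomial ℕ, ∀ lam, f lam ≤ p.eval lam

/-- `f(lam, q)` is at most `poly(lam, log q)`, with `log` the base-two logarithm rounded up. -/
def PolyLogBounded (f : ℕ → ℕ → ℕ) : Prop :=
  ∃ p : MvPolynomial (Fin 2) ℕ, ∀ lam q, f lam q ≤ MvPolynomial.eval ![lam, Nat.clog 2 q] p

/-- `f` is negligible: `lam ^ c * f lam` tends to `0` for every `c`. -/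
def Negligible (f : ℕ → ℝ) : Prop :=
  Asymptotics.SuperpolynomialDecay atTop (fun lam : ℕ => (lam : ℝ)) f

/-! ### Qubit registers

A register is a finite type `W` of qubits; its computational basis is `W → Bool`. -/

/-- Operators (in particular density matrices) on the register `W`. -/
abbrev Op (W : Type) : Type := Matrix (W → Bool) (W → Bool) ℂ

/-- The density matrix of the computational basis state `x`. -/
def basisState {W : Type} [DecidableEq W] [Fintype W] (x : W → Bool) : Op W :=
  Matrix.single x x 1

/-- The density matrix of the vector `psi`. -/
def pureState {W : Type} (psi : (W → Bool) → ℂ) : Op W :=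
  Matrix.vecMulVec psi (star psi)

/-- The state `rho` on `A` together with the state `sigma` on `B`. -/
def tensor {A B : Type} (rho : Op A) (sigma : Op B) : Op (A ⊕ B) :=
  Matrix.of fun u v =>
    rho (fun a => u (.inl a)) (fun a => v (.inl a)) *
      sigma (fun b => u (.inr b)) (fun b => v (.inr b))

/-- The product of the states `rho i`, each on its own copy of `W`. -/
def tensorPi {I W : Type} [Fintype I] (rho : I → Op W) : Op (I × W) :=
  Matrix.of fun u v => ∏ i, rho i (fun w => u (i, w)) (fun w => v (i, w))

open Classical in
/-- Partial trace: keep the qubits in the image of `f`, discard all others. -/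
def traceOut {O W : Type} [Fintype W] (f : O ↪ W) (rho : Op W) : Op O :=
  Matrix.of fun a b => ∑ u : W → Bool, ∑ v : W → Bool,
    if u ∘ f = a ∧ v ∘ f = b ∧ ∀ w ∉ Set.range f, u w = v w then rho u v else 0

/-- The (subnormalized) state of `B` after outcome `m` in a measurement of `A` in the
computational basis. -/
def afterOutcome {A B : Type} (m : A → Bool) (rho : Op (A ⊕ B)) : Op B :=
  Matrix.of fun u v => rho (Sum.elim m u) (Sum.elim m v)

/-! ### Quantum circuits over the gate set `H`, `T`, `CNOT` -/

/-- An elementary gate on the register `W`. -/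
inductive Gate (W : Type) : Type
  | had (w : W)
  | phaseT (w : W)
  | cnot (control target : W) (h : control ≠ target)

/-- The unitary matrix of a gate. -/
def Gate.mat {W : Type} [Fintype W] [DecidableEq W] : Gate W → Op W
  | .had w => Matrix.of fun a b =>
      if ∀ v, v ≠ w → a v = b v then
        (if a w && b w then (-1 : ℂ) else 1) / (Real.sqrt 2 : ℂ) else 0
  | .phaseT w => Matrix.diagonal fun a =>
      if a w then Complex.exp (Complex.I * Real.pi / 4) else 1
  | .cnot c t _ => Matrix.of fun a b =>
      if a = Function.update b t (xor (b t) (b c)) then 1 else 0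

/-- A quantum circuit with input register `I` and output register `O`: it adjoins `anc`
qubits in state `0`, applies the gates in order, and outputs the qubits selected by `out`,
discarding the others. -/
structure QCircuit (I O : Type) : Type where
  anc : ℕ
  gates : List (Gate (I ⊕ Fin anc))
  out : O ↪ I ⊕ Fin anc

namespace QCircuit

variable {I O : Type} [Fintype I] [DecidableEq I]

/-- Number of qubits plus number of gates. -/
def size (C : QCircuit I O) : ℕ :=
  Fintype.card I + C.anc + C.gates.length

/-- The unitary applied by the gates; the head of the list acts first. -/
def unitary (C : QCircuit I O) : Op (I ⊕ Fin C.anc) :=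
  C.gates.foldl (fun U g => g.mat * U) 1

/-- The channel computed by the circuit. -/
def run (C : QCircuit I O) (rho : Op I) : Op O :=
  traceOut C.out (C.unitary * tensor rho (basisState fun _ => false) * C.unitaryᴴ)

/-- Probability that measuring the single output qubit gives `b`. -/
def outputProb (C : QCircuit I Unit) (rho : Op I) (b : Bool) : ℝ :=
  (C.run rho (fun _ => b) (fun _ => b)).re

end QCircuit

/-! ### Pseudorandom function-like state generators -/

/-- The Haar measure on pure `n`-qubit states: the uniform probability measure on the unit
sphere of the `2 ^ n`-dimensional complex Hilbert space. -/
def haarState (n : ℕ) :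
    Measure (Metric.sphere (0 : EuclideanSpace ℂ (Fin n → Bool)) 1) :=
  ((Measure.addHaar : Measure (EuclideanSpace ℂ (Fin n → Bool))).toSphere Set.univ)⁻¹ •
    (Measure.addHaar : Measure (EuclideanSpace ℂ (Fin n → Bool))).toSphere

/-- The state `G(k, x)`. -/
def genState {K d n : ℕ} (G : QCircuit (Fin K ⊕ Fin d) (Fin n))
    (k : Fin K → Bool) (x : Fin d → Bool) : Op (Fin n) :=
  G.run (basisState (Sum.elim k x))

/-- The list `(x i, rho i ^ (⊗ t))`, `i < s`, handed to a distinguisher. -/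
def prfsSample {s d n : ℕ} (t : ℕ) (x : Fin s → Fin d → Bool) (rho : Fin s → Op (Fin n)) :
    Op (Fin s × (Fin d ⊕ Fin t × Fin n)) :=
  tensorPi fun i => tensor (basisState (x i)) (tensorPi fun _ : Fin t => rho i)

/-- Probability that `A` accepts on generator outputs under a uniformly random key. -/
def prfsReal {K d n s t : ℕ} (G : QCircuit (Fin K ⊕ Fin d) (Fin n))
    (x : Fin s → Fin d → Bool) (A : QCircuit (Fin s × (Fin d ⊕ Fin t × Fin n)) Unit) : ℝ :=
  (∑ k : Fin K → Bool, A.outputProb (prfsSample t x fun i => genState G k (x i)) true) / 2 ^ K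

/-- Probability that `A` accepts on independent Haar-random states. -/
def prfsIdeal {d n s t : ℕ}
    (x : Fin s → Fin d → Bool) (A : QCircuit (Fin s × (Fin d ⊕ Fin t × Fin n)) Unit) : ℝ :=
  ∫ psi : Fin s → Metric.sphere (0 : EuclideanSpace ℂ (Fin n → Bool)) 1,
    A.outputProb (prfsSample t x fun i => pureState fun a => (psi i).1 a) true
    ∂(Measure.pi fun _ => haarState n)

/-- The family `G`, with key length `lam`, input length `d lam` and output length `n lam`, is a
selectively secure PRFS generator: it has polynomial size, and no polynomial-size family of
circuits distinguishes its outputs on any family of distinct inputs, given polynomially many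
copies, from independent Haar-random states. -/
def SelectivelySecurePRFS (d n : ℕ → ℕ)
    (G : ∀ lam, QCircuit (Fin lam ⊕ Fin (d lam)) (Fin (n lam))) : Prop :=
  PolyBounded (fun lam => (G lam).size) ∧
  ∀ s t : ℕ → ℕ, PolyBounded s → PolyBounded t →
  ∀ A : ∀ lam, QCircuit (Fin (s lam) × (Fin (d lam) ⊕ Fin (t lam) × Fin (n lam))) Unit,
  PolyBounded (fun lam => (A lam).size) →
  ∀ x : ∀ lam, Fin (s lam) → Fin (d lam) → Bool, (∀ lam, Function.Injective (x lam)) →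
    Negligible fun lam => |prfsReal (G lam) (x lam) (A lam) - prfsIdeal (x lam) (A lam)|

/-! ### Query-bounded secret-key encryption with quantum ciphertexts -/

/-- A query-bounded secret-key encryption scheme for one-bit messages, with classical keys and
quantum ciphertexts. All data depend on the security parameter and on the query bound. -/
structure QSKE where
  /-- index set of the bits of a key -/
  KeyBit : ℕ → ℕ → Type
  /-- the qubits of a ciphertext -/
  CtQubit : ℕ → ℕ → Type
  [keyFintype : ∀ lam q, Fintype (KeyBit lam q)]
  [keyDecEq : ∀ lam q, DecidableEq (KeyBit lam q)]
  [ctFintype : ∀ lam q, Fintype (CtQubit lam q)]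
  [ctDecEq : ∀ lam q, DecidableEq (CtQubit lam q)]
  /-- distribution of the key -/
  gen : ∀ lam q, PMF (KeyBit lam q → Bool)
  /-- the ciphertext, as a density matrix -/
  enc : ∀ lam q, (KeyBit lam q → Bool) → Bool → Op (CtQubit lam q)
  /-- the probability of decrypting a given ciphertext to a given bit -/
  dec : ∀ lam q, (KeyBit lam q → Bool) → Op (CtQubit lam q) → Bool → ℝ

attribute [instance] QSKE.keyFintype QSKE.keyDecEq QSKE.ctFintype QSKE.ctDecEq

/-- Number of bits of a key. -/
def QSKE.keySize (S : QSKE) (lam q : ℕ) : ℕ := Fintype.card (S.KeyBit lam q)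

/-- Number of qubits of a ciphertext (classical bits count as qubits). -/
def QSKE.ctSize (S : QSKE) (lam q : ℕ) : ℕ := Fintype.card (S.CtQubit lam q)

/-- An adversary making at most `q` adaptive encryption queries, with ciphertext register `Ct`.
It starts with `mem` qubits in state `0`. In round `j` the circuit `ask j` produces a query,
whose qubits `false` and `true` are measured to give the messages `m₀` and `m₁`, and
`recv j` absorbs the ciphertext into the memory. Finally `guess` outputs a bit. -/
structure CPAAdversary (Ct : Type) (q : ℕ) : Type where
  rounds : ℕ
  rounds_le : rounds ≤ q
  mem : ℕ
  ask : ℕ → QCircuit (Fin mem) (Bool ⊕ Fin mem)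
  recv : ℕ → QCircuit (Fin mem ⊕ Ct) (Fin mem)
  guess : QCircuit (Fin mem) Unit

namespace CPAAdversary

variable {Ct : Type} [Fintype Ct] [DecidableEq Ct] {q : ℕ}

/-- Total size of the circuits of the adversary. -/
def size (A : CPAAdversary Ct q) : ℕ :=
  (∑ j ∈ Finset.range A.rounds, ((A.ask j).size + (A.recv j).size)) + A.guess.size

/-- State of the memory after `j` rounds of the game with challenge bit `b`, where `enc m` is
the encryption of `m` under the key of the game. -/
def state (A : CPAAdversary Ct q) (enc : Bool → Op Ct) (b : Bool) : ℕ → Op (Fin A.mem)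
  | 0 => basisState fun _ => false
  | j + 1 => ∑ m : Bool → Bool,
      (A.recv j).run
        (tensor (afterOutcome m ((A.ask j).run (A.state enc b j))) (enc (m b)))

end CPAAdversary

/-- Probability that `A` outputs `1` in the CPA game with challenge bit `b`. -/
def QSKE.cpaProb (S : QSKE) (lam q : ℕ) (A : CPAAdversary (S.CtQubit lam q) q)
    (b : Bool) : ℝ :=
  ∑ sk : S.KeyBit lam q → Bool, (S.gen lam q sk).toReal *
    A.guess.outputProb (A.state (S.enc lam q sk) b A.rounds) true

/-- CPA security for up to `q lam` queries against polynomial-size adversaries. -/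
def QSKE.CPASecure (S : QSKE) (q : ℕ → ℕ) : Prop :=
  ∀ A : ∀ lam, CPAAdversary (S.CtQubit lam (q lam)) (q lam),
    PolyBounded (fun lam => (A lam).size) →
    Negligible fun lam =>
      |S.cpaProb lam (q lam) (A lam) false - S.cpaProb lam (q lam) (A lam) true|

/-! ### The construction -/

/-- Exclusive or of a family of bits. -/
def xorAll {l : ℕ} (s : Fin l → Bool) : Bool := (List.ofFn s).foldr xor false

/-- The `d`-bit string `(r, s)`, for a `(d - 1)`-bit string `r` and a bit `s`. -/
def appendBit {d : ℕ} (r : Fin (d - 1) → Bool) (s : Bool) : Fin d → Bool :=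
  fun i => if h : i.1 < d - 1 then r ⟨i.1, h⟩ else s

/-- The state `(r i, G(k i, (r i, s i)))`, `i < l`. -/
def shareState {K d n l : ℕ} (G : QCircuit (Fin K ⊕ Fin d) (Fin n))
    (k : Fin l → Fin K → Bool) (r : Fin l → Fin (d - 1) → Bool) (s : Fin l → Bool) :
    Op (Fin l × (Fin (d - 1) ⊕ Fin n)) :=
  tensorPi fun i => tensor (basisState (r i)) (genState G (k i) (appendBit (r i) (s i)))

/-- Encryption of `m`: the shares `s` are uniform among those with exclusive or `m`, and the
tags `r` are uniform. -/
def shareEnc {K d n l : ℕ} (G : QCircuit (Fin K ⊕ Fin d) (Fin n))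
    (k : Fin l → Fin K → Bool) (m : Bool) : Op (Fin l × (Fin (d - 1) ⊕ Fin n)) :=
  ((Finset.univ.filter fun s : Fin l → Bool => xorAll s = m).card : ℂ)⁻¹ •
    ∑ s ∈ Finset.univ.filter (fun s : Fin l → Bool => xorAll s = m),
      (Fintype.card (Fin l → Fin (d - 1) → Bool) : ℂ)⁻¹ •
        ∑ r : Fin l → Fin (d - 1) → Bool, shareState G k r s

/-- The measurement operator of the event that `Test(k, x, ·)` outputs `o`. -/
def testEffect {K d n : ℕ} (Test : QCircuit ((Fin K ⊕ Fin d) ⊕ Fin n) Unit)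
    (k : Fin K → Bool) (x : Fin d → Bool) (o : Bool) : Op (Fin n) :=
  Matrix.of fun b a =>
    Test.run (tensor (basisState (Sum.elim k x)) (Matrix.single a b 1)) (fun _ => o) (fun _ => o)

/-- Probability of decrypting `sigma` to `m`: measure the tags `r`, run `Test(k i, (r i, 0), ·)`
on the `i`-th state for every `i`, take the `i`-th share to be `0` if the test accepts and `1`
otherwise, and output the exclusive or of the shares. -/
def shareDec {K d n l : ℕ} (Test : QCircuit ((Fin K ⊕ Fin d) ⊕ Fin n) Unit)
    (k : Fin l → Fin K → Bool) (sigma : Op (Fin l × (Fin (d - 1) ⊕ Fin n))) (m : Bool) : ℝ :=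
  (∑ s ∈ Finset.univ.filter (fun s : Fin l → Bool => xorAll s = m),
    ∑ r : Fin l → Fin (d - 1) → Bool,
      (tensorPi (fun i => tensor (basisState (r i))
        (testEffect Test (k i) (appendBit (r i) false) (!(s i)))) * sigma).trace).re

/-- The query-bounded scheme built from the generators `G lam q` with input length `d lam q` and
output length `n lam`. A key consists of `lam` generator keys of `lam` bits each. -/
def prfsQSKE (d : ℕ → ℕ → ℕ) (n : ℕ → ℕ)
    (G : ∀ lam q, QCircuit (Fin lam ⊕ Fin (d lam q)) (Fin (n lam)))
    (Test : ∀ lam q, QCircuit ((Fin lam ⊕ Fin (d lam q)) ⊕ Fin (n lam)) Unit) : QSKE where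
  KeyBit lam _ := Fin lam × Fin lam
  CtQubit lam q := Fin lam × (Fin (d lam q - 1) ⊕ Fin (n lam))
  gen lam _ := PMF.uniformOfFintype (Fin lam × Fin lam → Bool)
  enc lam q sk m := shareEnc (G lam q) (fun i a => sk (i, a)) m
  dec lam q sk sigma m := shareDec (Test lam q) (fun i a => sk (i, a)) sigma m

end

/-!
The advantage of a CPA adversary is bounded by the advantage of circuits that distinguish the
generator from Haar-random states.

**Tags.** Since `2 ^ (d - 1) ≥ q ^ 2`, the tags with a given index collide in some two of the at
most `q` ciphertexts with probability at most `1 / 2` (`pow_mul_le_descFactorial`). The `lam`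
indices are independent, so up to probability `2 ^ (-lam)` there is an index `i0` whose tags are all
distinct (`expect_forall_not_injective_le`). As tags do not depend on the queries, they may be fixed
before the game starts.

**Reduction.** Fix such tags, and also all shares and keys with indices other than `i0`; these are
nonuniform advice. The share with index `i0` of an answer to the query `m` is `m b ⊕ c` for a known
bit `c`, so the answer contains `G (k, (r, m b ⊕ c))` for the unknown key `k`, and everything else in
it can be prepared by the reduction. The reduction asks for the states `G (k, (r, 0))` and
`G (k, (r, 1))` of every round, `2 q` distinct inputs in all, and plays the game with them
(`CPAAdversary.exists_distinguisher`). In each round it must choose one of two states according to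
a measured bit. A controlled swap does this, made of `H`, `T` and `CNOT`; as the control is
discarded afterwards, the measurement need not be carried out (`Converts.select`).

**Haar-random states.** If the states given to the reduction are independent and identically
distributed, then its output does not depend on the challenge bit. The acceptance probability is
multilinear in the answers of the rounds, hence a sum over transcripts of queries
(`CPAAdversary.accept_eq_sum`), and for a fixed transcript a permutation of the states exchanges the
choices made for the two challenge bits (`CPAAdversary.integral_accept_eq`). The same multilinearity
allows the average over tags and shares to be taken outside the game
(`CPAAdversary.accept_average`).

Circuits are composed through the relation `Converts rho sigma k`, which says that one circuit of
cost at most `k` maps `rho i` to `sigma i` for all `i`. It is closed under composition, tensoring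
with a further register, and rearrangement of qubits, with additive costs, so that the size of the
reduction is read off from its description.
-/

/-! ### Partial traces and tensor products -/

section PartialTrace

variable {A B O P Q R W : Type}

theorem tensor_apply (rho : Op A) (sigma : Op B) (u v : A ⊕ B → Bool) :
    tensor rho sigma u v = rho (fun a => u (.inl a)) (fun a => v (.inl a)) *
      sigma (fun b => u (.inr b)) (fun b => v (.inr b)) := rfl

@[simp]
theorem tensor_elim (rho : Op A) (sigma : Op B) (a a' : A → Bool) (b b' : B → Bool) :
    tensor rho sigma (Sum.elim a b) (Sum.elim a' b') = rho a a' * sigma b b' := rfl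

theorem tensorPi_apply {I : Type} [Fintype I] (rho : I → Op W) (u v : I × W → Bool) :
    tensorPi rho u v = ∏ i, rho i (fun w => u (i, w)) (fun w => v (i, w)) := rfl

theorem basisState_apply [DecidableEq W] [Fintype W] (x u v : W → Bool) :
    basisState x u v = if x = u ∧ x = v then 1 else 0 := by
  simp [basisState, Matrix.single]

/-- The partial trace in coordinates: once the qubits of `W` are split by `e` into the kept ones and
the others, it sums over the values of the others. -/
theorem traceOut_eq_sum [Fintype W] [Fintype R] [DecidableEq R] (e : O ⊕ R ≃ W) (f : O ↪ W)
    (hf : ∀ o, f o = e (.inl o)) (rho : Op W) (a b : O → Bool) :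
    traceOut f rho a b =
      ∑ y : R → Bool, rho (Sum.elim a y ∘ e.symm) (Sum.elim b y ∘ e.symm) := by
  classical
  have hrange : ∀ r, e (.inr r) ∉ Set.range f := by
    rintro r ⟨o, ho⟩
    rw [hf] at ho
    simpa using e.injective ho
  have key : ∀ (u : W → Bool) (a : O → Bool), u ∘ f = a →
      u = Sum.elim a (fun r => u (e (.inr r))) ∘ e.symm := by
    intro u a h
    funext w
    obtain ⟨z, rfl⟩ := e.surjective w
    rcases z with o | r
    · simp [← h, hf]
    · simp
  have htr : traceOut f rho a b = ∑ p : (W → Bool) × (W → Bool),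
      if p.1 ∘ f = a ∧ p.2 ∘ f = b ∧ ∀ w ∉ Set.range f, p.1 w = p.2 w then rho p.1 p.2 else 0 := by
    rw [Fintype.sum_prod_type]
    simp only [traceOut, Matrix.of_apply]
  rw [htr, ← Finset.sum_filter]
  refine Finset.sum_bij' (fun p _ r => p.1 (e (.inr r)))
    (fun y _ => (Sum.elim a y ∘ e.symm, Sum.elim b y ∘ e.symm)) ?_ ?_ ?_ ?_ ?_
  · simp
  · intro y _
    simp only [Finset.mem_filter, Finset.mem_univ, true_and]
    refine ⟨?_, ?_, ?_⟩
    · funext o; simp [hf]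
    · funext o; simp [hf]
    · intro w hw
      obtain ⟨z, rfl⟩ := e.surjective w
      rcases z with o | r
      · exact absurd ⟨o, hf o⟩ hw
      · simp
  · rintro ⟨u, v⟩ h
    simp only [Finset.mem_filter, Finset.mem_univ, true_and] at h
    obtain ⟨h1, h2, h3⟩ := h
    refine Prod.ext (key u a h1).symm ?_
    rw [key v b h2]
    simp only
    congr 2
    funext r
    exact h3 _ (hrange r)
  · intro y _
    funext r; simp
  · rintro ⟨u, v⟩ h
    simp only [Finset.mem_filter, Finset.mem_univ, true_and] at h
    obtain ⟨h1, h2, h3⟩ := h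
    have hv := key v b h2
    have : (fun r => v (e (.inr r))) = fun r => u (e (.inr r)) :=
      funext fun r => (h3 _ (hrange r)).symm
    rw [this] at hv
    rw [← key u a h1, ← hv]

/-- The splitting of `W` into the image of `f` and its complement. -/
noncomputable def complEquiv (f : O ↪ W) : O ⊕ {w // w ∉ Set.range f} ≃ W := by
  classical
  exact ((Equiv.ofInjective f f.injective).sumCongr (Equiv.refl _)).trans
    (Equiv.Set.sumCompl (Set.range f))

theorem complEquiv_inl (f : O ↪ W) (o : O) : complEquiv f (.inl o) = f o := by
  classical
  exact Equiv.Set.sumCompl_apply_inl _ _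

/-- Every partial trace has the coordinate form of `traceOut_eq_sum`. -/
theorem exists_splitting [Fintype W] (f : O ↪ W) :
    ∃ (R : Type) (_ : Fintype R) (_ : DecidableEq R) (e : O ⊕ R ≃ W),
      ∀ o, f o = e (.inl o) := by
  classical
  exact ⟨{w // w ∉ Set.range f}, inferInstance, inferInstance, complEquiv f,
    fun o => (complEquiv_inl f o).symm⟩

theorem traceOut_equiv [Fintype W] (e : O ≃ W) (rho : Op W) (a b : O → Bool) :
    traceOut e.toEmbedding rho a b = rho (a ∘ e.symm) (b ∘ e.symm) := by
  rw [traceOut_eq_sum ((Equiv.sumEmpty O Empty).trans e) e.toEmbedding (fun o => by simp)]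
  rw [Fintype.sum_eq_single (fun r : Empty => r.elim) (fun y h => absurd (Subsingleton.elim _ _) h)]
  congr 1

theorem traceOut_inl [Fintype A] [Fintype B] [DecidableEq B] (rho : Op (A ⊕ B)) (a a' : A → Bool) :
    traceOut Function.Embedding.inl rho a a' =
      ∑ y : B → Bool, rho (Sum.elim a y) (Sum.elim a' y) :=
  traceOut_eq_sum (Equiv.refl _) _ (fun _ => rfl) rho a a'

theorem traceOut_refl [Fintype W] (rho : Op W) :
    traceOut (Function.Embedding.refl W) rho = rho := by
  ext a b
  exact traceOut_equiv (Equiv.refl W) rho a b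

theorem sum_sumArrow {M : Type*} [AddCommMonoid M] [Fintype A] [Fintype B] [DecidableEq A]
    [DecidableEq B] (f : (A ⊕ B → Bool) → M) :
    ∑ u, f u = ∑ a : A → Bool, ∑ b : B → Bool, f (Sum.elim a b) := by
  rw [← Fintype.sum_prod_type']
  exact (Equiv.sum_comp (Equiv.sumArrowEquivProdArrow A B Bool).symm f).symm

theorem sum_splitting {M : Type*} [AddCommMonoid M] [Fintype A] [Fintype B] [DecidableEq A]
    [DecidableEq B] [Fintype W] [DecidableEq W] (e : A ⊕ B ≃ W) (f : (W → Bool) → M) :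
    ∑ u, f u = ∑ a : A → Bool, ∑ b : B → Bool, f (Sum.elim a b ∘ e.symm) := by
  rw [← sum_sumArrow (fun u => f (u ∘ e.symm))]
  exact (Equiv.sum_comp (e.arrowCongr (Equiv.refl Bool)) f).symm

theorem traceOut_traceOut [Fintype W] [Fintype O] (f : O ↪ W) (g : P ↪ O) (rho : Op W) :
    traceOut g (traceOut f rho) = traceOut (g.trans f) rho := by
  obtain ⟨R, _, _, e, he⟩ := exists_splitting f
  obtain ⟨S, _, _, e', he'⟩ := exists_splitting g
  ext a b
  rw [traceOut_eq_sum e' g he',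
    traceOut_eq_sum ((Equiv.sumAssoc P S R).symm.trans ((e'.sumCongr (Equiv.refl R)).trans e))
      (g.trans f) (fun o => by simp [he, he'])]
  rw [sum_sumArrow]
  refine Finset.sum_congr rfl fun y _ => ?_
  rw [traceOut_eq_sum e f he]
  refine Finset.sum_congr rfl fun z _ => ?_
  congr 1
  all_goals
    funext w
    obtain ⟨t, rfl⟩ := e.surjective w
    rcases t with o | r
    · obtain ⟨t, rfl⟩ := e'.surjective o
      rcases t with p | s <;> simp
    · simp

theorem traceOut_add [Fintype W] (f : O ↪ W) (rho sigma : Op W) :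
    traceOut f (rho + sigma) = traceOut f rho + traceOut f sigma := by
  obtain ⟨R, _, _, e, he⟩ := exists_splitting f
  ext a b
  simp [traceOut_eq_sum e f he, Finset.sum_add_distrib]

theorem traceOut_smul [Fintype W] (f : O ↪ W) (c : ℂ) (rho : Op W) :
    traceOut f (c • rho) = c • traceOut f rho := by
  obtain ⟨R, _, _, e, he⟩ := exists_splitting f
  ext a b
  simp [traceOut_eq_sum e f he, Finset.mul_sum]

theorem tensor_traceOut [Fintype W] [Fintype B] (f : O ↪ W) (rho : Op W) (sigma : Op B) :
    tensor (traceOut f rho) sigma =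
      traceOut (f.sumMap (Function.Embedding.refl B)) (tensor rho sigma) := by
  classical
  obtain ⟨R, _, _, e, he⟩ := exists_splitting f
  ext u v
  rw [traceOut_eq_sum (R := R)
    ((Equiv.sumAssoc O B R).trans (((Equiv.refl O).sumCongr (Equiv.sumComm B R)).trans
      ((Equiv.sumAssoc O R B).symm.trans (e.sumCongr (Equiv.refl B)))))
    _ (by rintro (o | b) <;> simp [he])]
  rw [tensor_apply, traceOut_eq_sum e f he, Finset.sum_mul]
  refine Finset.sum_congr rfl fun y _ => ?_
  rw [tensor_apply]
  congr 2
  all_goals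
    funext w
    obtain ⟨t, rfl⟩ := e.surjective w
    rcases t with o | r <;> simp

theorem tensor_add_left (rho rho' : Op A) (sigma : Op B) :
    tensor (rho + rho') sigma = tensor rho sigma + tensor rho' sigma := by
  ext u v; simp [tensor_apply, add_mul]

theorem tensor_smul_left (c : ℂ) (rho : Op A) (sigma : Op B) :
    tensor (c • rho) sigma = c • tensor rho sigma := by
  ext u v; simp [tensor_apply, mul_assoc]

theorem tensor_add_right (rho : Op A) (sigma sigma' : Op B) :
    tensor rho (sigma + sigma') = tensor rho sigma + tensor rho sigma' := by
  ext u v; simp [tensor_apply, mul_add]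

theorem tensor_smul_right (c : ℂ) (rho : Op A) (sigma : Op B) :
    tensor rho (c • sigma) = c • tensor rho sigma := by
  ext u v; simp [tensor_apply, mul_left_comm]

theorem tensor_mul [Fintype A] [DecidableEq A] [Fintype B] [DecidableEq B]
    (M M' : Op A) (N N' : Op B) :
    tensor (M * M') (N * N') = tensor M N * tensor M' N' := by
  ext u v
  rw [tensor_apply, Matrix.mul_apply, Matrix.mul_apply, Matrix.mul_apply, sum_sumArrow,
    Finset.sum_mul_sum]
  refine Finset.sum_congr rfl fun a _ => Finset.sum_congr rfl fun b _ => ?_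
  simp only [tensor_apply, Sum.elim_inl, Sum.elim_inr]
  ring

theorem tensor_conjTranspose (M : Op A) (N : Op B) : (tensor M N)ᴴ = tensor Mᴴ Nᴴ := by
  ext u v
  simp [tensor_apply, Matrix.conjTranspose_apply]

theorem tensor_basisState [Fintype A] [DecidableEq A] [Fintype B] [DecidableEq B]
    (x : A → Bool) (y : B → Bool) :
    tensor (basisState x) (basisState y) = basisState (Sum.elim x y) := by
  ext u v
  have h : ∀ u : A ⊕ B → Bool, Sum.elim x y = u ↔
      x = (fun a => u (.inl a)) ∧ y = fun b => u (.inr b) := by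
    intro u
    constructor
    · rintro rfl; exact ⟨rfl, rfl⟩
    · rintro ⟨rfl, rfl⟩; funext z; rcases z <;> rfl
  simp only [tensor_apply, basisState_apply, h, ite_mul, one_mul, zero_mul, ← ite_and]
  exact if_congr (by tauto) rfl rfl

theorem traceOut_equiv_basisState [Fintype W] [DecidableEq W] [Fintype O] [DecidableEq O]
    (e : O ≃ W) (x : W → Bool) :
    traceOut e.toEmbedding (basisState x) = basisState (x ∘ e) := by
  ext a b
  have h : ∀ a : O → Bool, x = a ∘ e.symm ↔ x ∘ e = a := by
    intro a
    rw [Equiv.eq_comp_symm]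
  rw [traceOut_equiv, basisState_apply, basisState_apply]
  simp only [h]

end PartialTrace

/-! ### Gate sequences acting on operators -/

section Evolve

variable {A B I O P Q R W : Type}

/-- The same gate on a larger register. -/
def Gate.map (f : A ↪ W) : Gate A → Gate W
  | .had w => .had (f w)
  | .phaseT w => .phaseT (f w)
  | .cnot c t h => .cnot (f c) (f t) (f.injective.ne h)

/-- A gate on a larger register acts as the identity on the additional qubits. -/
theorem Gate.map_mat_splitting [Fintype A] [DecidableEq A] [Fintype W] [DecidableEq W]
    [Fintype R] [DecidableEq R] (e : A ⊕ R ≃ W) (f : A ↪ W) (hf : ∀ o, f o = e (.inl o))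
    (g : Gate A) (a b : A → Bool) (y z : R → Bool) :
    (g.map f).mat (Sum.elim a y ∘ e.symm) (Sum.elim b z ∘ e.symm) =
      if y = z then g.mat a b else 0 := by
  have hall : ∀ p : W → Prop, (∀ w, p w) ↔ (∀ o, p (e (.inl o))) ∧ ∀ r, p (e (.inr r)) := by
    intro p
    rw [← e.forall_congr_right, Sum.forall]
  have hyz : ∀ y z : R → Bool, y = z ↔ ∀ r, y r = z r := fun _ _ => funext_iff
  cases g with
  | had w =>
    simp only [Gate.map, Gate.mat, Matrix.of_apply]
    simp only [hall]
    simp only [hf, Function.comp, e.symm_apply_apply, Sum.elim_inl, Sum.elim_inr, hyz y z]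
    have h1 : ∀ o : A, e (.inl o) ≠ e (.inl w) ↔ o ≠ w := by simp
    have h2 : ∀ r : R, e (.inr r) ≠ e (.inl w) := by simp
    simp only [h1, h2, ne_eq, not_false_eq_true, true_imp_iff]
    by_cases hp : ∀ v, v ≠ w → a v = b v <;> by_cases hq : ∀ r, y r = z r <;> simp [hp, hq]
  | phaseT w =>
    simp only [Gate.map, Gate.mat, Matrix.diagonal_apply, funext_iff]
    simp only [hall]
    simp only [hf, Function.comp, e.symm_apply_apply, Sum.elim_inl, Sum.elim_inr]
    by_cases hp : ∀ v, a v = b v <;> by_cases hq : ∀ r, y r = z r <;> simp [hp, hq]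
  | cnot c t h =>
    simp only [Gate.map, Gate.mat, Matrix.of_apply, funext_iff]
    simp only [hall]
    simp only [hf, Function.comp, e.symm_apply_apply, Sum.elim_inl, Sum.elim_inr,
      Function.update_apply, e.injective.eq_iff, Sum.inl.injEq, reduceCtorEq, if_false]
    by_cases hp : ∀ o, a o = if o = t then (b t ^^ b c) else b o <;>
      by_cases hq : ∀ r, y r = z r <;> simp [hp, hq]

theorem Gate.map_inl_mat [Fintype A] [DecidableEq A] [Fintype B] [DecidableEq B] (g : Gate A) :
    (g.map (Function.Embedding.inl : A ↪ A ⊕ B)).mat = tensor g.mat 1 := by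
  ext u v
  have h := Gate.map_mat_splitting (Equiv.refl (A ⊕ B)) Function.Embedding.inl (fun _ => rfl) g
    (u ∘ Sum.inl) (v ∘ Sum.inl) (u ∘ Sum.inr) (v ∘ Sum.inr)
  simp only [Equiv.refl_symm, Equiv.coe_refl, Function.comp_id, Sum.elim_comp_inl_inr] at h
  rw [h, tensor_apply, Matrix.one_apply]
  split_ifs with h1 h2 h2
  · simp [Function.comp_def]
  · exact absurd h1 h2
  · exact absurd h2 h1
  · simp

/-- An operator `L` that acts as `U` on the kept qubits and as the identity on the others passes
through the partial trace. -/
theorem mul_traceOut [Fintype A] [DecidableEq A] [Fintype W] [DecidableEq W] [Fintype R]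
    [DecidableEq R] (e : A ⊕ R ≃ W) (f : A ↪ W) (hf : ∀ o, f o = e (.inl o)) (U : Op A) (L M : Op W)
    (hL : ∀ a b y z, L (Sum.elim a y ∘ e.symm) (Sum.elim b z ∘ e.symm) =
      if y = z then U a b else 0) :
    U * traceOut f M = traceOut f (L * M) := by
  ext a b
  rw [traceOut_eq_sum e f hf, Matrix.mul_apply]
  simp only [Matrix.mul_apply, sum_splitting e, hL, ite_mul, zero_mul, Finset.sum_ite_eq,
    Finset.mem_univ, if_true, traceOut_eq_sum e f hf, Finset.mul_sum]
  rw [Finset.sum_comm]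

theorem traceOut_conjTranspose [Fintype W] (f : A ↪ W) (M : Op W) :
    (traceOut f M)ᴴ = traceOut f Mᴴ := by
  obtain ⟨R, _, _, e, he⟩ := exists_splitting f
  ext a b
  simp [traceOut_eq_sum e f he, Matrix.conjTranspose_apply]

/-- Gates on kept qubits may be applied before the other qubits are discarded. -/
theorem Gate.conj_traceOut [Fintype A] [DecidableEq A] [Fintype W] [DecidableEq W]
    (f : A ↪ W) (g : Gate A) (M : Op W) :
    g.mat * traceOut f M * g.matᴴ = traceOut f ((g.map f).mat * M * (g.map f).matᴴ) := by
  obtain ⟨R, _, _, e, he⟩ := exists_splitting f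
  have h := mul_traceOut e f he g.mat (g.map f).mat
  rw [h M (Gate.map_mat_splitting e f he g)]
  rw [← Matrix.conjTranspose_conjTranspose (traceOut f _), ← Matrix.conjTranspose_mul,
    traceOut_conjTranspose, h _ (Gate.map_mat_splitting e f he g), traceOut_conjTranspose]
  simp [Matrix.conjTranspose_mul, Matrix.mul_assoc]

/-- The action of a list of gates on operators, by conjugation; the head of the list acts first. -/
noncomputable def evolve [Fintype W] [DecidableEq W] (gs : List (Gate W)) (M : Op W) : Op W :=
  gs.foldl (fun M g => g.mat * M * g.matᴴ) M

section

variable [Fintype W] [DecidableEq W]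

@[simp] theorem evolve_nil (M : Op W) : evolve [] M = M := rfl

@[simp] theorem evolve_cons (g : Gate W) (gs : List (Gate W)) (M : Op W) :
    evolve (g :: gs) M = evolve gs (g.mat * M * g.matᴴ) := rfl

theorem evolve_append (gs hs : List (Gate W)) (M : Op W) :
    evolve (gs ++ hs) M = evolve hs (evolve gs M) := List.foldl_append

theorem evolve_eq_conj (gs : List (Gate W)) (M U : Op W) :
    evolve gs (U * M * Uᴴ) =
      gs.foldl (fun U g => g.mat * U) U * M * (gs.foldl (fun U g => g.mat * U) U)ᴴ := by
  induction gs generalizing U with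
  | nil => rfl
  | cons g gs ih =>
    rw [evolve_cons, List.foldl_cons, ← ih]
    simp [Matrix.conjTranspose_mul, Matrix.mul_assoc]

theorem evolve_add (gs : List (Gate W)) (M N : Op W) :
    evolve gs (M + N) = evolve gs M + evolve gs N := by
  induction gs generalizing M N with
  | nil => rfl
  | cons g gs ih => simp [Matrix.mul_add, Matrix.add_mul, ih]

theorem evolve_smul (gs : List (Gate W)) (c : ℂ) (M : Op W) :
    evolve gs (c • M) = c • evolve gs M := by
  induction gs generalizing M with
  | nil => rfl
  | cons g gs ih => simp [ih]

theorem evolve_traceOut [Fintype A] [DecidableEq A] (f : A ↪ W) (gs : List (Gate A)) (M : Op W) :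
    evolve gs (traceOut f M) = traceOut f (evolve (gs.map (Gate.map f)) M) := by
  induction gs generalizing M with
  | nil => rfl
  | cons g gs ih => rw [evolve_cons, Gate.conj_traceOut, ih]; rfl

theorem tensor_evolve [Fintype A] [DecidableEq A] (gs : List (Gate A)) (M : Op A) (N : Op W) :
    tensor (evolve gs M) N =
      evolve (gs.map (Gate.map Function.Embedding.inl)) (tensor M N) := by
  induction gs generalizing M with
  | nil => rfl
  | cons g gs ih =>
    rw [evolve_cons, ih, List.map_cons, evolve_cons, Gate.map_inl_mat, tensor_conjTranspose,
      ← tensor_mul, ← tensor_mul]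
    simp

end

theorem QCircuit.run_eq [Fintype I] [DecidableEq I] (C : QCircuit I O) (rho : Op I) :
    C.run rho = traceOut C.out (evolve C.gates (tensor rho (basisState fun _ => false))) := by
  have h := evolve_eq_conj C.gates (tensor rho (basisState fun _ => false)) 1
  simp only [Matrix.one_mul, Matrix.conjTranspose_one, Matrix.mul_one] at h
  rw [h]
  rfl

theorem QCircuit.run_add [Fintype I] [DecidableEq I] (C : QCircuit I O) (rho sigma : Op I) :
    C.run (rho + sigma) = C.run rho + C.run sigma := by
  simp only [QCircuit.run_eq, tensor_add_left, evolve_add, traceOut_add]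

theorem QCircuit.run_smul [Fintype I] [DecidableEq I] (C : QCircuit I O) (c : ℂ) (rho : Op I) :
    C.run (c • rho) = c • C.run rho := by
  simp only [QCircuit.run_eq, tensor_smul_left, evolve_smul, traceOut_smul]

/-- The channel computed by a circuit as a linear map. -/
noncomputable def QCircuit.runL [Fintype I] [DecidableEq I] (C : QCircuit I O) :
    Op I →ₗ[ℂ] Op O where
  toFun := C.run
  map_add' := C.run_add
  map_smul' := C.run_smul

theorem QCircuit.run_sum [Fintype I] [DecidableEq I] {ι : Type*} (C : QCircuit I O)
    (s : Finset ι) (rho : ι → Op I) : C.run (∑ i ∈ s, rho i) = ∑ i ∈ s, C.run (rho i) :=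
  map_sum C.runL rho s

end Evolve

/-! ### Conversion of families of states by circuits -/

section Converts

variable {ι : Type*} {A B I O P W : Type}

/-- A single circuit with at most `k` ancillas and gates maps the state `rho i` to `sigma i`, for
all `i`. The qubits of the input register are not counted, so that costs add up under
composition and do not grow when a further register is carried along. -/
def Converts [Fintype I] [DecidableEq I] (rho : ι → Op I) (sigma : ι → Op O) (k : ℕ) : Prop :=
  ∃ C : QCircuit I O, C.anc + C.gates.length ≤ k ∧ ∀ i, C.run (rho i) = sigma i

variable [Fintype I] [DecidableEq I]

theorem Converts.mono {rho : ι → Op I} {sigma : ι → Op O} {k l : ℕ} (h : Converts rho sigma k)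
    (hkl : k ≤ l) : Converts rho sigma l :=
  h.imp fun _ hC => ⟨hC.1.trans hkl, hC.2⟩

theorem Converts.congr {rho : ι → Op I} {sigma sigma' : ι → Op O} {k : ℕ}
    (h : Converts rho sigma k) (hs : ∀ i, sigma i = sigma' i) : Converts rho sigma' k :=
  h.imp fun _ hC => ⟨hC.1, fun i => (hC.2 i).trans (hs i)⟩

theorem Converts.comap {κ : Type*} {rho : ι → Op I} {sigma : ι → Op O} {k : ℕ}
    (h : Converts rho sigma k) (f : κ → ι) :
    Converts (fun j => rho (f j)) (fun j => sigma (f j)) k :=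
  h.imp fun _ hC => ⟨hC.1, fun j => hC.2 (f j)⟩

theorem tensor_traceOut_right_equiv [Fintype A] [Fintype B] [Fintype W] (e : B ≃ W) (rho : Op A)
    (sigma : Op W) :
    tensor rho (traceOut e.toEmbedding sigma) =
      traceOut ((Equiv.refl A).sumCongr e).toEmbedding (tensor rho sigma) := by
  ext u v
  rw [traceOut_equiv, tensor_apply, tensor_apply, traceOut_equiv]
  rfl

theorem trace_basisState [Fintype W] [DecidableEq W] (x : W → Bool) : (basisState x).trace = 1 := by
  simp [basisState]

theorem traceOut_inl_tensor [Fintype A] [Fintype B] [DecidableEq B] (rho : Op A) (sigma : Op B) :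
    traceOut Function.Embedding.inl (tensor rho sigma) = sigma.trace • rho := by
  ext a a'
  rw [traceOut_inl]
  simp [Matrix.trace, Finset.mul_sum, mul_comm]

/-- Ancillas may be indexed by any finite type. -/
theorem Converts.of_gates {Anc : Type} [Fintype Anc] [DecidableEq Anc]
    {rho : ι → Op I} {sigma : ι → Op O} (gates : List (Gate (I ⊕ Anc))) (out : O ↪ I ⊕ Anc)
    (h : ∀ i, traceOut out (evolve gates (tensor (rho i) (basisState fun _ => false))) = sigma i) :
    Converts rho sigma (Fintype.card Anc + gates.length) := by
  let e : Anc ≃ Fin (Fintype.card Anc) := Fintype.equivFin Anc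
  let F := (Equiv.refl I).sumCongr e
  refine ⟨⟨Fintype.card Anc, gates.map (Gate.map F.toEmbedding), out.trans F.toEmbedding⟩,
    by simp, fun i => ?_⟩
  rw [QCircuit.run_eq, ← h i]
  simp only
  rw [← traceOut_traceOut, ← evolve_traceOut, ← tensor_traceOut_right_equiv,
    traceOut_equiv_basisState]
  rfl

theorem Converts.run (C : QCircuit I O) (rho : ι → Op I) :
    Converts rho (fun i => C.run (rho i)) (C.anc + C.gates.length) :=
  ⟨C, le_rfl, fun _ => rfl⟩

theorem Converts.evolve (gs : List (Gate I)) (rho : ι → Op I) :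
    Converts rho (fun i => evolve gs (rho i)) gs.length := by
  refine (Converts.of_gates (Anc := Fin 0) (gs.map (Gate.map Function.Embedding.inl))
    Function.Embedding.inl fun i => ?_).mono (by simp)
  rw [← tensor_evolve, traceOut_inl_tensor, trace_basisState, one_smul]

/-- Discarding and rearranging qubits is free. -/
theorem Converts.traceOut (f : O ↪ I) (rho : ι → Op I) :
    Converts rho (fun i => traceOut f (rho i)) 0 := by
  refine (Converts.of_gates (Anc := Fin 0) [] (f.trans Function.Embedding.inl) fun i => ?_).mono
    (by simp)
  rw [← traceOut_traceOut, evolve_nil, traceOut_inl_tensor, trace_basisState, one_smul]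

/-- Adjoining qubits in state `0` costs as many ancillas. -/
theorem Converts.tensor_zero [Fintype B] [DecidableEq B] (rho : ι → Op I) :
    Converts rho (fun i => tensor (rho i) (basisState fun _ : B => false)) (Fintype.card B) :=
  (Converts.of_gates (Anc := B) [] (Function.Embedding.refl _) fun _ => traceOut_refl _).mono
    (by simp)

/-- The ancillas and gates of the second circuit may be placed before the final discarding of the
first one, so that composite circuits are again circuits. -/
theorem Converts.trans [Fintype O] [DecidableEq O] {rho : ι → Op I} {sigma : ι → Op O}
    {tau : ι → Op P} {k l : ℕ} (h : Converts rho sigma k) (h' : Converts sigma tau l) :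
    Converts rho tau (k + l) := by
  obtain ⟨C, hC, hrun⟩ := h
  obtain ⟨D, hD, hrun'⟩ := h'
  let E := Equiv.sumAssoc I (Fin C.anc) (Fin D.anc)
  let F : O ⊕ Fin D.anc ↪ (I ⊕ Fin C.anc) ⊕ Fin D.anc :=
    C.out.sumMap (Function.Embedding.refl _)
  refine (Converts.of_gates (Anc := Fin C.anc ⊕ Fin D.anc)
    (((C.gates.map (Gate.map Function.Embedding.inl)) ++ D.gates.map (Gate.map F)).map
      (Gate.map E.toEmbedding))
    ((D.out.trans F).trans E.toEmbedding) fun i => ?_).mono (by simp; omega)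
  rw [← hrun' i, ← hrun i, QCircuit.run_eq D, QCircuit.run_eq C, tensor_traceOut,
    tensor_evolve, evolve_traceOut, traceOut_traceOut, ← evolve_append,
    ← traceOut_traceOut _ (D.out.trans F), ← evolve_traceOut]
  congr 2
  ext u v
  rw [traceOut_equiv, tensor_apply, tensor_apply, tensor_apply, mul_assoc]
  simp only [basisState_apply, ← ite_and, mul_ite, mul_one, mul_zero]
  have h : ∀ u : (I ⊕ Fin C.anc) ⊕ Fin D.anc → Bool,
      (fun _ => false) = (fun b => (u ∘ E.symm) (.inr b)) ↔
        ((fun _ => false) = fun a => u (.inl (.inr a))) ∧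
          (fun _ => false) = fun b => u (.inr b) := by
    intro u
    simp only [funext_iff, Sum.forall]
    rfl
  simp only [h]
  refine if_congr (by tauto) rfl rfl

/-- A circuit may be applied to a part of the register. -/
theorem Converts.tensor_right [Fintype B] [DecidableEq B] {rho : ι → Op I} {sigma : ι → Op O}
    {k : ℕ} (h : Converts rho sigma k) (theta : ι → Op B) :
    Converts (fun i => tensor (rho i) (theta i)) (fun i => tensor (sigma i) (theta i)) k := by
  obtain ⟨C, hC, hrun⟩ := h
  let E : (I ⊕ Fin C.anc) ⊕ B ≃ (I ⊕ B) ⊕ Fin C.anc :=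
    (Equiv.sumAssoc _ _ _).trans (((Equiv.refl I).sumCongr (Equiv.sumComm _ _)).trans
      (Equiv.sumAssoc _ _ _).symm)
  refine (Converts.of_gates (Anc := Fin C.anc)
    ((C.gates.map (Gate.map Function.Embedding.inl)).map (Gate.map E.toEmbedding))
    ((C.out.sumMap (Function.Embedding.refl B)).trans E.toEmbedding) fun i => ?_).mono
    (by simpa using hC)
  rw [← hrun i, QCircuit.run_eq C, tensor_traceOut, tensor_evolve, ← traceOut_traceOut,
    ← evolve_traceOut]
  congr 2
  ext u v
  rw [traceOut_equiv, tensor_apply, tensor_apply, tensor_apply, tensor_apply, mul_right_comm]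
  rfl

theorem traceOut_equiv_symm_apply [Fintype A] [Fintype W] (e : A ≃ W) (rho : Op A) :
    traceOut e.toEmbedding (traceOut e.symm.toEmbedding rho) = rho := by
  ext u v
  rw [traceOut_equiv, traceOut_equiv]
  congr 1 <;> (funext a; simp)

theorem traceOut_sumComm [Fintype A] [Fintype B] (rho : Op A) (sigma : Op B) :
    traceOut (Equiv.sumComm B A).toEmbedding (tensor rho sigma) = tensor sigma rho := by
  ext u v
  rw [traceOut_equiv, tensor_apply, tensor_apply, mul_comm]
  rfl

theorem traceOut_inr_tensor [Fintype A] [DecidableEq A] [Fintype B] (rho : Op A) (sigma : Op B) :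
    traceOut Function.Embedding.inr (tensor rho sigma) = rho.trace • sigma := by
  have h : (Function.Embedding.inr : B ↪ A ⊕ B) =
      Function.Embedding.inl.trans (Equiv.sumComm B A).toEmbedding := rfl
  rw [h, ← traceOut_traceOut, traceOut_sumComm, traceOut_inl_tensor]

theorem Converts.assoc [Fintype A] [DecidableEq A] [Fintype B] [DecidableEq B] [Fintype W]
    [DecidableEq W] (rho : ι → Op A) (sigma : ι → Op B) (tau : ι → Op W) :
    Converts (fun i => tensor (rho i) (tensor (sigma i) (tau i)))
      (fun i => tensor (tensor (rho i) (sigma i)) (tau i)) 0 := by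
  refine (Converts.traceOut (Equiv.sumAssoc A B W).toEmbedding _).congr fun i => ?_
  ext u v
  rw [traceOut_equiv, tensor_apply, tensor_apply, tensor_apply, tensor_apply, mul_assoc]
  rfl

theorem Converts.swap [Fintype A] [DecidableEq A] [Fintype B] [DecidableEq B] (rho : ι → Op A)
    (sigma : ι → Op B) :
    Converts (fun i => tensor (rho i) (sigma i)) (fun i => tensor (sigma i) (rho i)) 0 :=
  (Converts.traceOut (Equiv.sumComm B A).toEmbedding _).congr fun _ => traceOut_sumComm _ _

theorem Converts.tensor_left [Fintype B] [DecidableEq B] [Fintype O] [DecidableEq O]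
    {rho : ι → Op I} {sigma : ι → Op O} {k : ℕ} (h : Converts rho sigma k) (theta : ι → Op B) :
    Converts (fun i => tensor (theta i) (rho i)) (fun i => tensor (theta i) (sigma i)) k :=
  (((Converts.swap theta rho).trans (h.tensor_right theta)).trans
    (Converts.swap sigma theta)).mono (by omega)

end Converts

/-! ### Reversible gadgets from `H`, `T` and `CNOT` -/

section Gadgets

variable {ι : Type*} {A B I M N O P W : Type} [Fintype W] [DecidableEq W]

/-- The action of a list of gates on vectors; the head of the list acts first. -/
noncomputable def applyGates (gs : List (Gate W)) (v : (W → Bool) → ℂ) : (W → Bool) → ℂ :=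
  gs.foldl (fun v g => g.mat *ᵥ v) v

@[simp] theorem applyGates_nil (v : (W → Bool) → ℂ) : applyGates [] v = v := rfl

@[simp] theorem applyGates_cons (g : Gate W) (gs : List (Gate W)) (v : (W → Bool) → ℂ) :
    applyGates (g :: gs) v = applyGates gs (g.mat *ᵥ v) := rfl

theorem applyGates_append (gs hs : List (Gate W)) (v : (W → Bool) → ℂ) :
    applyGates (gs ++ hs) v = applyGates hs (applyGates gs v) := List.foldl_append

theorem applyGates_foldl (gs : List (Gate W)) (U : Op W) (v : (W → Bool) → ℂ) :
    gs.foldl (fun U g => g.mat * U) U *ᵥ v = applyGates gs (U *ᵥ v) := by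
  induction gs generalizing U with
  | nil => rfl
  | cons g gs ih => rw [List.foldl_cons, ih, applyGates_cons, Matrix.mulVec_mulVec]

/-- If a list of gates permutes the computational basis, then it permutes rows and columns of
density matrices. -/
theorem evolve_of_applyGates (gs : List (Gate W)) (s : (W → Bool) → W → Bool)
    (h : ∀ v u, applyGates gs v u = v (s u)) (M : Op W) (u v : W → Bool) :
    evolve gs M u v = M (s u) (s v) := by
  have hev := evolve_eq_conj gs M 1
  simp only [Matrix.one_mul, Matrix.conjTranspose_one, Matrix.mul_one] at hev
  set U : Op W := gs.foldl (fun U g => g.mat * U) 1 with hU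
  have hU' : ∀ u w, U u w = if s u = w then 1 else 0 := by
    intro u w
    have := h (Pi.single w 1) u
    rw [show applyGates gs (Pi.single w 1) = U *ᵥ Pi.single w 1 by
      rw [hU, applyGates_foldl, Matrix.one_mulVec], Matrix.mulVec_single_one] at this
    simpa [Pi.single_apply] using this
  rw [hev, Matrix.mul_apply]
  simp [Matrix.mul_apply, hU', Matrix.conjTranspose_apply]

theorem had_mulVec (w : W) (v : (W → Bool) → ℂ) (u : W → Bool) :
    ((Gate.had w).mat *ᵥ v) u = (v (Function.update u w false) +
      (if u w then -1 else 1) * v (Function.update u w true)) / (Real.sqrt 2 : ℂ) := by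
  have hne : Function.update u w false ≠ Function.update u w true := by
    intro h; simpa using congrFun h w
  have hsub : ({Function.update u w false, Function.update u w true} : Finset (W → Bool)) =
      Finset.univ.filter fun b => ∀ z, z ≠ w → u z = b z := by
    ext b
    simp only [Finset.mem_insert, Finset.mem_singleton, Finset.mem_filter, Finset.mem_univ,
      true_and]
    constructor
    · rintro (rfl | rfl) z hz <;> simp [hz]
    · intro h
      have : b = Function.update u w (b w) := by
        funext z
        by_cases hz : z = w
        · subst hz; simp
        · simp [hz, h z hz]
      rw [this]
      cases b w <;> simp
  simp only [Matrix.mulVec, dotProduct, Gate.mat, Matrix.of_apply, ite_mul, zero_mul]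
  rw [← Finset.sum_filter, ← hsub, Finset.sum_pair hne]
  simp only [Function.update_self, Bool.and_false, Bool.and_true, Bool.false_eq_true, if_false]
  split_ifs <;> ring

theorem phaseT_mulVec (w : W) (v : (W → Bool) → ℂ) (u : W → Bool) :
    ((Gate.phaseT w).mat *ᵥ v) u =
      (if u w then Complex.exp (Complex.I * Real.pi / 4) else 1) * v u := by
  simp [Gate.mat, Matrix.mulVec_diagonal]

theorem cnot_mulVec (c t : W) (h : c ≠ t) (v : (W → Bool) → ℂ) (u : W → Bool) :
    ((Gate.cnot c t h).mat *ᵥ v) u = v (Function.update u t (xor (u t) (u c))) := by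
  have key : ∀ b : W → Bool, u = Function.update b t (xor (b t) (b c)) ↔
      Function.update u t (xor (u t) (u c)) = b := by
    intro b
    constructor
    · rintro rfl
      simp [h]
    · rintro rfl
      simp [h]
  simp only [Matrix.mulVec, dotProduct, Gate.mat, Matrix.of_apply, key, ite_mul, one_mul, zero_mul]
  rw [Finset.sum_ite_eq]
  simp

/-- The `j`-th power of the `T` gate. -/
def phasePow (w : W) (j : ℕ) : List (Gate W) := List.replicate j (.phaseT w)

theorem applyGates_phasePow (w : W) (j : ℕ) (v : (W → Bool) → ℂ) (u : W → Bool) :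
    applyGates (phasePow w j) v u =
      (if u w then Complex.exp (Complex.I * Real.pi / 4) ^ j else 1) * v u := by
  induction j generalizing v with
  | zero => simp [phasePow]
  | succ j ih =>
    rw [phasePow, List.replicate_succ, applyGates_cons, ← phasePow, ih, phaseT_mulVec]
    split_ifs <;> ring

theorem exp_pi_div_four_pow_four : Complex.exp (Complex.I * Real.pi / 4) ^ 4 = -1 := by
  rw [← Complex.exp_nat_mul, ← Complex.exp_pi_mul_I]
  congr 1
  push_cast
  ring

/-- The `X` gate, as `H T⁴ H`. -/
def notGates (w : W) : List (Gate W) := [.had w] ++ phasePow w 4 ++ [.had w]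

theorem sqrt_two_mul_self : (Real.sqrt 2 : ℂ) * (Real.sqrt 2 : ℂ) = 2 := by
  rw [← Complex.ofReal_mul, Real.mul_self_sqrt (by norm_num)]
  norm_num

theorem sqrt_two_ne_zero : (Real.sqrt 2 : ℂ) ≠ 0 := by
  intro h
  have := sqrt_two_mul_self
  simp [h] at this

theorem applyGates_notGates (w : W) (v : (W → Bool) → ℂ) (u : W → Bool) :
    applyGates (notGates w) v u = v (Function.update u w (!u w)) := by
  simp only [notGates, applyGates_append, applyGates_cons, applyGates_nil, had_mulVec,
    applyGates_phasePow, exp_pi_div_four_pow_four, Function.update_self, Function.update_idem]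
  have h := sqrt_two_mul_self
  have h0 := sqrt_two_ne_zero
  have hu : Function.update u w (u w) = u := by simp
  cases huw : u w <;> simp only [huw] at hu <;> simp only [Bool.not_false, Bool.not_true] <;>
    simp <;> field_simp <;> rw [pow_two, h] <;> ring

/-- A power of the `T` gate controlled by the parity of `a` and `b`. -/
def parityPhase (a b : W) (h : a ≠ b) (j : ℕ) : List (Gate W) :=
  [.cnot a b h] ++ phasePow b j ++ [.cnot a b h]

theorem applyGates_parityPhase (a b : W) (h : a ≠ b) (j : ℕ) (v : (W → Bool) → ℂ) (u : W → Bool) :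
    applyGates (parityPhase a b h j) v u =
      (if xor (u b) (u a) then Complex.exp (Complex.I * Real.pi / 4) ^ j else 1) * v u := by
  simp [parityPhase, applyGates_append, cnot_mulVec, applyGates_phasePow, h]

/-- The doubly controlled sign on three qubits. Its phase `(-1)^(abc)` is obtained from
`4abc = a + b + c - (a ⊕ b) - (a ⊕ c) - (b ⊕ c) + (a ⊕ b ⊕ c)`. -/
def ccz (a b c : W) (hab : a ≠ b) (hac : a ≠ c) (hbc : b ≠ c) : List (Gate W) :=
  phasePow a 1 ++ phasePow b 1 ++ phasePow c 1 ++
    parityPhase a b hab 7 ++ parityPhase a c hac 7 ++ parityPhase b c hbc 7 ++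
    ([.cnot a c hac] ++ parityPhase b c hbc 1 ++ [.cnot a c hac])

theorem applyGates_ccz (a b c : W) (hab : a ≠ b) (hac : a ≠ c) (hbc : b ≠ c)
    (v : (W → Bool) → ℂ) (u : W → Bool) :
    applyGates (ccz a b c hab hac hbc) v u = (if u a && u b && u c then -1 else 1) * v u := by
  have h4 := exp_pi_div_four_pow_four
  have h8 : Complex.exp (Complex.I * Real.pi / 4) ^ 8 = 1 := by
    rw [show 8 = 4 * 2 from rfl, pow_mul, h4]; norm_num
  simp only [ccz, applyGates_append, applyGates_cons, applyGates_nil, cnot_mulVec,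
    applyGates_phasePow, applyGates_parityPhase, Function.update_self, Function.update_idem, ne_eq,
    hac, hbc, not_false_eq_true, Function.update_of_ne, Bool.xor_assoc, Bool.xor_self,
    Bool.xor_false, Function.update_eq_self]
  generalize Complex.exp (Complex.I * Real.pi / 4) = z at *
  cases u a <;> cases u b <;> cases u c <;> simp only [Bool.xor_false, Bool.xor_true,
    Bool.not_true, Bool.not_false, Bool.and_true, Bool.and_false, Bool.false_eq_true, if_true,
    if_false, one_mul]
  all_goals first
    | rfl
    | (linear_combination (v u) * h8)
    | (linear_combination (v u) * (z ^ 8 + 1) * h8)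
    | (linear_combination (v u) * h4)

/-- The Toffoli gate with controls `a`, `b` and target `c`. -/
def toffoli (a b c : W) (hab : a ≠ b) (hac : a ≠ c) (hbc : b ≠ c) : List (Gate W) :=
  [.had c] ++ ccz a b c hab hac hbc ++ [.had c]

theorem applyGates_toffoli (a b c : W) (hab : a ≠ b) (hac : a ≠ c) (hbc : b ≠ c)
    (v : (W → Bool) → ℂ) (u : W → Bool) :
    applyGates (toffoli a b c hab hac hbc) v u =
      v (Function.update u c (xor (u c) (u a && u b))) := by
  have h := sqrt_two_mul_self
  have h0 := sqrt_two_ne_zero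
  have hu : Function.update u c (u c) = u := by simp
  simp only [toffoli, applyGates_append, applyGates_cons, applyGates_nil, had_mulVec,
    applyGates_ccz, Function.update_self, Function.update_idem, ne_eq, hac, hbc, not_false_eq_true,
    Function.update_of_ne, Bool.and_false, Bool.and_true, Bool.false_eq_true, if_false, if_true]
  cases huc : u c <;> cases (u a && u b) <;> simp only [huc] at hu <;>
    simp <;> field_simp <;> rw [pow_two, h] <;> ring

/-- The exchange of the qubits `x` and `y` controlled by `a`. -/
def controlledSwap (a x y : W) (hax : a ≠ x) (hay : a ≠ y) (hxy : x ≠ y) : List (Gate W) :=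
  [.cnot y x hxy.symm] ++ toffoli a x y hax hay hxy ++ [.cnot y x hxy.symm]

theorem applyGates_controlledSwap (a x y : W) (hax : a ≠ x) (hay : a ≠ y) (hxy : x ≠ y)
    (v : (W → Bool) → ℂ) (u : W → Bool) :
    applyGates (controlledSwap a x y hax hay hxy) v u =
      v (if u a then u ∘ Equiv.swap x y else u) := by
  simp only [controlledSwap, applyGates_append, applyGates_cons, applyGates_nil, cnot_mulVec,
    applyGates_toffoli]
  congr 1
  funext w
  by_cases hx : w = x
  · subst hx
    cases hua : u a <;> cases hux : u w <;> cases huy : u y <;>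
      simp [hax, hxy, hxy.symm, hua, hux, huy]
  · by_cases hy : w = y
    · subst hy
      cases hua : u a <;> cases hux : u x <;> cases huy : u w <;>
        simp [hax, hxy, hxy.symm, hua, hux, huy]
    · cases hua : u a <;> simp [hx, hy, Equiv.swap_apply_of_ne_of_ne]

theorem evolve_notGates (w : W) (M : Op W) (u v : W → Bool) :
    evolve (notGates w) M u v =
      M (Function.update u w (!u w)) (Function.update v w (!v w)) :=
  evolve_of_applyGates _ (fun u => Function.update u w (!u w))
    (fun _ _ => applyGates_notGates _ _ _) M u v

theorem evolve_notGates_basisState (w : W) (x : W → Bool) :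
    evolve (notGates w) (basisState x) = basisState (Function.update x w (!x w)) := by
  have h : ∀ u : W → Bool, x = Function.update u w (!u w) ↔ Function.update x w (!x w) = u := by
    intro u
    constructor <;> rintro rfl <;> simp
  ext u v
  rw [evolve_notGates, basisState_apply, basisState_apply]
  simp only [h]

/-- Gates that prepare the basis state `x` on the qubits of a list, from the zero state. -/
def setBits (x : W → Bool) (l : List W) : List (Gate W) :=
  l.flatMap fun w => if x w then notGates w else []

theorem evolve_setBits (x z : W → Bool) (l : List W) (hl : l.Nodup) (hz : ∀ w ∈ l, z w = false) :
    evolve (setBits x l) (basisState z) = basisState fun w => if w ∈ l then x w else z w := by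
  induction l generalizing z with
  | nil => simp [setBits]
  | cons w l ih =>
    obtain ⟨hw, hl⟩ := List.nodup_cons.1 hl
    have hstep : evolve (if x w then notGates w else []) (basisState z) =
        basisState (Function.update z w (x w)) := by
      have hzw := hz w (by simp)
      split_ifs with hx
      · rw [evolve_notGates_basisState, hzw, hx]; rfl
      · have hx' : x w = z w := by rw [hzw]; simpa using hx
        rw [hx', Function.update_eq_self]
        rfl
    rw [setBits, List.flatMap_cons, evolve_append, ← setBits, hstep, ih _ hl]
    · congr 1
      funext w'
      by_cases h : w' = w
      · subst h; simp
      · simp [h]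
    · intro w' hw'
      have : w' ≠ w := fun h => hw (h ▸ hw')
      rw [Function.update_of_ne this]
      exact hz _ (by simp [hw'])

theorem evolve_setBits_univ (x : W → Bool) :
    evolve (setBits x Finset.univ.toList) (basisState fun _ => false) = basisState x := by
  rw [evolve_setBits _ _ _ (Finset.nodup_toList _) (fun _ _ => rfl)]
  simp

end Gadgets

section GateCounts

variable {W : Type}

theorem length_controlledSwap (a x y : W) (hax : a ≠ x) (hay : a ≠ y) (hxy : x ≠ y) :
    (controlledSwap a x y hax hay hxy).length = 39 := by
  simp [controlledSwap, toffoli, ccz, parityPhase, phasePow]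

theorem length_setBits_le (x : W → Bool) (l : List W) : (setBits x l).length ≤ 6 * l.length := by
  induction l with
  | nil => simp [setBits]
  | cons w l ih =>
    rw [setBits, List.flatMap_cons, List.length_append, ← setBits, List.length_cons]
    have : (if x w then notGates w else []).length ≤ 6 := by
      split_ifs <;> simp [notGates, phasePow]
    omega

end GateCounts

theorem Converts.tensor_basisState {ι : Type*} {B I : Type} [Fintype I] [DecidableEq I]
    [Fintype B] [DecidableEq B]
    (rho : ι → Op I) (x : B → Bool) :
    Converts rho (fun i => tensor (rho i) (basisState x)) (7 * Fintype.card B) := by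
  have h := ((Converts.evolve (setBits x Finset.univ.toList)
    (fun _ : ι => basisState fun _ : B => false)).tensor_left rho)
  simp only [evolve_setBits_univ] at h
  refine ((Converts.tensor_zero rho).trans h).mono ?_
  have := length_setBits_le x (Finset.univ : Finset B).toList
  rw [Finset.length_toList, Finset.card_univ] at this
  omega

/-! ### Selecting one of two states by a measured bit -/

section Select

variable {ι κ : Type*} {A B I M N O P W : Type}

/-- Controlled exchange of the two copies of the qubits of a list, with control `c`. -/
def swapCopies (c : A) (l : List N) : List (Gate (A ⊕ (N ⊕ N))) :=
  l.flatMap fun w => controlledSwap (.inl c) (.inr (.inl w)) (.inr (.inr w))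
    (by simp) (by simp) (by simp)

theorem length_swapCopies (c : A) (l : List N) : (swapCopies c l).length = 39 * l.length := by
  induction l with
  | nil => rfl
  | cons w l ih =>
    rw [swapCopies, List.flatMap_cons, List.length_append, ← swapCopies, ih,
      length_controlledSwap, List.length_cons]
    ring

theorem applyGates_swapCopies [Fintype A] [DecidableEq A] [Fintype N] [DecidableEq N]
    (c : A) (l : List N) (hl : l.Nodup) (v : (A ⊕ (N ⊕ N) → Bool) → ℂ) (u : A ⊕ (N ⊕ N) → Bool) :
    applyGates (swapCopies c l) v u = v (Sum.elim (fun a => u (.inl a))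
      (Sum.elim (fun w => if w ∈ l ∧ u (.inl c) then u (.inr (.inr w)) else u (.inr (.inl w)))
        (fun w => if w ∈ l ∧ u (.inl c) then u (.inr (.inl w)) else u (.inr (.inr w))))) := by
  induction l generalizing v with
  | nil =>
    simp only [swapCopies, List.flatMap_nil, applyGates_nil, List.not_mem_nil, false_and, if_false]
    congr 1
    funext z
    rcases z with a | w | w <;> rfl
  | cons w l ih =>
    obtain ⟨hw, hl⟩ := List.nodup_cons.1 hl
    rw [swapCopies, List.flatMap_cons, applyGates_append, ← swapCopies, ih hl,
      applyGates_controlledSwap]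
    congr 1
    simp only [Sum.elim_inl]
    by_cases hc : u (.inl c) = true
    · simp only [hc, and_true, if_true]
      funext z
      rcases z with a | z | z
      · simp [Equiv.swap_apply_of_ne_of_ne]
      · by_cases hz : z = w
        · subst hz; simp [hw]
        · simp [hz, Equiv.swap_apply_of_ne_of_ne]
      · by_cases hz : z = w
        · subst hz; simp [hw]
        · simp [hz, Equiv.swap_apply_of_ne_of_ne]
    · simp [hc]

theorem evolve_swapCopies [Fintype A] [DecidableEq A] [Fintype N] [DecidableEq N]
    (c : A) (T : Op (A ⊕ (N ⊕ N))) (a a' : A → Bool) (x y x' y' : N → Bool) :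
    evolve (swapCopies c Finset.univ.toList) T (Sum.elim a (Sum.elim x y))
        (Sum.elim a' (Sum.elim x' y')) =
      T (Sum.elim a (if a c then Sum.elim y x else Sum.elim x y))
        (Sum.elim a' (if a' c then Sum.elim y' x' else Sum.elim x' y')) := by
  rw [evolve_of_applyGates _ _ (applyGates_swapCopies c _ (Finset.nodup_toList _))]
  have h : ∀ (a : A → Bool) (x y : N → Bool),
      Sum.elim (fun w => if a c then y w else x w) (fun w => if a c then x w else y w) =
        if a c then Sum.elim y x else Sum.elim x y := by
    intro a x y; split_ifs <;> rfl
  simp only [Finset.mem_toList, Finset.mem_univ, true_and, Sum.elim_inl, Sum.elim_inr, h]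

/-- Discarding the control of the exchange amounts to measuring it, so that no separate measurement
is needed to choose one of the two states according to the outcome. -/
theorem Converts.select [Fintype P] [DecidableEq P] [Fintype M] [DecidableEq M] [Fintype N]
    [DecidableEq N] (b : P) (tau : ι → Op (P ⊕ M)) (phi : ι → Bool → Op N)
    (hphi : ∀ i s, (phi i s).trace = 1) (c : Bool) :
    Converts (fun i => tensor (tau i) (tensor (phi i false) (phi i true)))
      (fun i => ∑ m : P → Bool, tensor (afterOutcome m (tau i)) (phi i (xor (m b) c)))
      (39 * Fintype.card N) := by
  have base : ∀ phi : ι → Bool → Op N, (∀ i s, (phi i s).trace = 1) →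
      Converts (fun i => tensor (tau i) (tensor (phi i false) (phi i true)))
        (fun i => ∑ m : P → Bool, tensor (afterOutcome m (tau i)) (phi i (m b)))
        (39 * Fintype.card N) := by
    intro phi hphi
    let e : (M ⊕ N) ⊕ (P ⊕ N) ≃ (P ⊕ M) ⊕ (N ⊕ N) :=
      (Equiv.sumSumSumComm M N P N).trans ((Equiv.sumComm M P).sumCongr (Equiv.refl _))
    refine (((Converts.evolve (swapCopies (Sum.inl b) Finset.univ.toList) _).trans
      (Converts.traceOut (Function.Embedding.inl.trans e.toEmbedding) _)).mono
        (by simp [length_swapCopies])).congr fun i => ?_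
    ext u v
    rw [traceOut_eq_sum e _ (fun _ => rfl), sum_sumArrow, Matrix.sum_apply]
    refine Finset.sum_congr rfl fun m _ => ?_
    have he : ∀ (u : M ⊕ N → Bool) (y : N → Bool), Sum.elim u (Sum.elim m y) ∘ e.symm =
        Sum.elim (Sum.elim m (fun a => u (.inl a))) (Sum.elim (fun w => u (.inr w)) y) := by
      intro u y
      funext z
      obtain ⟨z, rfl⟩ := e.surjective z
      rw [Function.comp, e.symm_apply_apply]
      rcases z with (z | z) | (z | z) <;> rfl
    simp only [he, evolve_swapCopies, Sum.elim_inl]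
    by_cases hm : m b = true
    swap
    · rw [Bool.not_eq_true] at hm
      simp only [hm, Bool.false_eq_true, if_false, tensor_elim, ← Finset.mul_sum]
      rw [show ∑ y, phi i true y y = 1 from hphi i true, mul_one]
      rfl
    · simp only [hm, if_true, tensor_elim, ← Finset.mul_sum, ← Finset.sum_mul]
      rw [show ∑ y, phi i false y y = 1 from hphi i false, one_mul]
      rfl
  cases c
  · simpa using base phi hphi
  · have h := base (fun i s => phi i (!s)) (fun i s => hphi i _)
    simp only [Bool.not_false, Bool.not_true] at h
    refine (((Converts.swap (fun i => phi i false) (fun i => phi i true)).tensor_left tau).trans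
      h).mono (by simp) |>.congr fun i => ?_
    simp

/-- By linearity, a circuit that converts a family also converts sums over that family. -/
theorem Converts.sum [Fintype I] [DecidableEq I] {rho : κ → Op I} {sigma : κ → Op O} {k : ℕ}
    (h : Converts rho sigma k) {μ : Type*} (s : Finset μ) (f : ι → μ → κ) :
    Converts (fun i => ∑ m ∈ s, rho (f i m)) (fun i => ∑ m ∈ s, sigma (f i m)) k := by
  obtain ⟨C, hC, hrun⟩ := h
  refine ⟨C, hC, fun i => ?_⟩
  rw [QCircuit.run_sum]
  simp only [hrun]

end Select

/-! ### Preparation of fixed states and products over index sets -/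

section Prepare

variable {ι : Type*} {A B I J J' M N O P W : Type}

/-- The state `sigma` can be prepared from the empty register by at most `k` ancillas and gates. -/
def Preparable (sigma : Op O) (k : ℕ) : Prop :=
  Converts (fun _ : Unit => basisState (fun e : Empty => e.elim)) (fun _ => sigma) k

theorem tensor_empty_left [Fintype A] (rho : Op A) (x : Empty → Bool) :
    traceOut (Equiv.emptySum Empty A).symm.toEmbedding (tensor (basisState x) rho) = rho := by
  ext a b
  rw [traceOut_equiv, tensor_apply, basisState_apply, if_pos ⟨Subsingleton.elim _ _,
    Subsingleton.elim _ _⟩, one_mul]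
  rfl

theorem Preparable.attach [Fintype I] [DecidableEq I] [Fintype O] [DecidableEq O]
    {sigma : Op O} {k : ℕ} (h : Preparable sigma k) (rho : ι → Op I) :
    Converts rho (fun i => tensor (rho i) sigma) k := by
  have h0 : Converts rho (fun i => tensor (rho i) (basisState fun e : Empty => e.elim)) 0 := by
    refine ((Converts.tensor_zero (B := Empty) rho).mono (by simp)).congr fun i => ?_
    congr 2
    exact Subsingleton.elim _ _
  exact (h0.trans ((h.comap fun _ : ι => ()).tensor_left rho)).mono (by simp)

theorem Preparable.mono {sigma : Op O} {k l : ℕ} (h : Preparable sigma k) (hkl : k ≤ l) :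
    Preparable sigma l := Converts.mono h hkl

theorem Preparable.trans [Fintype I] [DecidableEq I] {rho : Op I} {sigma : Op O} {k l : ℕ}
    (h : Preparable rho k) (h' : Converts (fun _ : Unit => rho) (fun _ => sigma) l) :
    Preparable sigma (k + l) := Converts.trans h h'

theorem Preparable.tensor [Fintype A] [DecidableEq A] [Fintype B] [DecidableEq B]
    {rho : Op A} {sigma : Op B} {k l : ℕ} (h : Preparable rho k) (h' : Preparable sigma l) :
    Preparable (tensor rho sigma) (k + l) := h.trans (h'.attach _)

theorem Preparable.run [Fintype I] [DecidableEq I] {rho : Op I} {k : ℕ} (h : Preparable rho k)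
    (C : QCircuit I O) : Preparable (C.run rho) (k + (C.anc + C.gates.length)) :=
  h.trans (Converts.run C _)

theorem preparable_basisState [Fintype B] [DecidableEq B] (x : B → Bool) :
    Preparable (basisState x) (7 * Fintype.card B) := by
  have h := (Converts.tensor_basisState (fun _ : Unit => basisState (fun e : Empty => e.elim)) x)
  exact (h.trans (Converts.traceOut (Equiv.emptySum Empty B).symm.toEmbedding _)).congr
    fun _ => tensor_empty_left _ _

/-- Splitting off one factor of a product register. -/
def splitFactor (e : Option J' ≃ J) : W ⊕ J' × W ≃ J × W where
  toFun := Sum.elim (fun w => (e none, w)) (fun p => (e (some p.1), p.2))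
  invFun p := match e.symm p.1 with
    | none => .inl p.2
    | some j => .inr (j, p.2)
  left_inv z := by rcases z with w | ⟨j, w⟩ <;> simp
  right_inv p := by
    obtain ⟨j, w⟩ := p
    obtain ⟨j, rfl⟩ := e.surjective j
    rcases j with _ | j <;> simp

theorem traceOut_tensor_tensorPi [Fintype J] [Fintype J'] [Fintype W] (e : Option J' ≃ J)
    (sigma : J → Op W) :
    traceOut (splitFactor e).symm.toEmbedding
      (tensor (sigma (e none)) (tensorPi fun j => sigma (e (some j)))) = tensorPi sigma := by
  ext u v
  rw [traceOut_equiv, tensor_apply, tensorPi_apply, tensorPi_apply,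
    ← Equiv.prod_comp e, Fintype.prod_option]
  rfl

theorem traceOut_tensorPi [Fintype J] [Fintype J'] [Fintype W] (e : Option J' ≃ J)
    (sigma : J → Op W) :
    traceOut (splitFactor e).toEmbedding (tensorPi sigma) =
      tensor (sigma (e none)) (tensorPi fun j => sigma (e (some j))) := by
  rw [← traceOut_tensor_tensorPi e]
  exact traceOut_equiv_symm_apply (splitFactor e) _

theorem preparable_tensorPi [Fintype J] [DecidableEq J] [Fintype W] [DecidableEq W]
    (sigma : J → Op W) (k : ℕ) (h : ∀ j, Preparable (sigma j) k) :
    Preparable (tensorPi sigma) (Fintype.card J * k) := by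
  induction hm : Fintype.card J generalizing J with
  | zero =>
    have : IsEmpty J := Fintype.card_eq_zero_iff.1 hm
    rw [zero_mul]
    refine (Converts.traceOut (Equiv.equivOfIsEmpty (J × W) Empty).toEmbedding _).congr fun _ => ?_
    ext u v
    rw [traceOut_equiv, basisState_apply, tensorPi_apply, if_pos ⟨Subsingleton.elim _ _,
      Subsingleton.elim _ _⟩]
    simp
  | succ m ih =>
    have : Nonempty J := Fintype.card_pos_iff.1 (by omega)
    obtain ⟨j0⟩ := this
    have e : Option {j // j ≠ j0} ≃ J := Equiv.optionSubtypeNe j0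
    have hrest := ih (J := {j // j ≠ j0}) (fun j => sigma (e (some j))) (fun j => h _)
      (by simp [Fintype.card_subtype_compl, hm])
    have := ((h (e none)).tensor hrest).trans
      ((Converts.traceOut (splitFactor e).symm.toEmbedding _).congr
        fun _ => traceOut_tensor_tensorPi e sigma)
    exact this.mono (by ring_nf; rfl)

end Prepare

/-! ### Density matrices are preserved -/

section IsState

open scoped ComplexOrder

variable {ι : Type*} {A B I O W : Type}

/-- Density matrices: positive semidefinite operators of trace one. -/
def IsState [Fintype W] [DecidableEq W] (rho : Op W) : Prop := rho.PosSemidef ∧ rho.trace = 1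

theorem trace_tensor [Fintype A] [DecidableEq A] [Fintype B] [DecidableEq B]
    (rho : Op A) (sigma : Op B) : (tensor rho sigma).trace = rho.trace * sigma.trace := by
  simp only [Matrix.trace, Matrix.diag]
  rw [sum_sumArrow, Finset.sum_mul_sum]
  rfl

theorem posSemidef_tensor [Fintype A] [DecidableEq A] [Fintype B] [DecidableEq B]
    {rho : Op A} {sigma : Op B} (h : rho.PosSemidef) (h' : sigma.PosSemidef) :
    (tensor rho sigma).PosSemidef :=
  (h.kronecker h').submatrix fun u : A ⊕ B → Bool => (u ∘ Sum.inl, u ∘ Sum.inr)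

theorem isState_basisState [Fintype W] [DecidableEq W] (x : W → Bool) :
    IsState (basisState x) := by
  refine ⟨?_, trace_basisState x⟩
  have : basisState x = Matrix.vecMulVec (Pi.single x 1) (star (Pi.single x 1)) := by
    ext u v
    rw [basisState_apply, Matrix.vecMulVec_apply, Pi.star_apply, Pi.single_apply, Pi.single_apply]
    by_cases h : u = x <;> by_cases h' : v = x <;> simp [h, h', eq_comm (a := x)]
  rw [this]
  exact Matrix.posSemidef_vecMulVec_self_star _

theorem posSemidef_traceOut [Fintype W] {f : O ↪ W} {rho : Op W} (h : rho.PosSemidef) :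
    (traceOut f rho).PosSemidef := by
  obtain ⟨R, _, _, e, he⟩ := exists_splitting f
  have : traceOut f rho = ∑ y : R → Bool, rho.submatrix
      (fun a => Sum.elim a y ∘ e.symm) (fun a => Sum.elim a y ∘ e.symm) := by
    ext a b
    rw [traceOut_eq_sum e f he, Matrix.sum_apply]
    rfl
  rw [this]
  exact Matrix.posSemidef_sum _ fun y _ => h.submatrix _

theorem trace_traceOut [Fintype W] [DecidableEq W] [Fintype O] [DecidableEq O] (f : O ↪ W)
    (rho : Op W) : (traceOut f rho).trace = rho.trace := by
  obtain ⟨R, _, _, e, he⟩ := exists_splitting f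
  simp only [Matrix.trace, Matrix.diag]
  rw [sum_splitting e]
  simp only [traceOut_eq_sum e f he]

theorem Gate.conjTranspose_mul_mat [Fintype W] [DecidableEq W] (g : Gate W) :
    g.matᴴ * g.mat = 1 := by
  -- `H` and `CNOT` are Hermitian involutions
  have key : ∀ U : Op W, Uᴴ = U → (∀ v, U *ᵥ (U *ᵥ v) = v) → Uᴴ * U = 1 := by
    intro U hU h
    rw [hU]
    refine Matrix.mulVec_injective ?_
    funext v
    rw [← Matrix.mulVec_mulVec, h, Matrix.one_mulVec]
  cases g with
  | had w =>
    refine key _ ?_ fun v => ?_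
    · ext a b
      simp only [Matrix.conjTranspose_apply, Gate.mat, Matrix.of_apply]
      simp only [eq_comm (a := b _), Bool.and_comm (b w)]
      split_ifs <;> simp [Complex.conj_ofReal]
    · funext u
      have h := sqrt_two_mul_self
      have h0 := sqrt_two_ne_zero
      have hu : Function.update u w (u w) = u := by simp
      simp only [had_mulVec, Function.update_self, Function.update_idem]
      cases huw : u w <;> simp only [huw] at hu <;> simp [hu] <;> field_simp <;>
        rw [pow_two, h] <;> ring
  | phaseT w =>
    simp only [Gate.mat, Matrix.diagonal_conjTranspose, Matrix.diagonal_mul_diagonal]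
    rw [← Matrix.diagonal_one]
    congr 1
    funext a
    simp only [Pi.star_apply]
    split_ifs
    · have h4 : (starRingEnd ℂ) (4 : ℂ) = 4 := Complex.conj_ofNat 4
      rw [Complex.star_def, ← Complex.exp_conj, ← Complex.exp_add]
      simp only [map_div₀, map_mul, Complex.conj_I, Complex.conj_ofReal, h4]
      ring_nf
      exact Complex.exp_zero
    · simp
  | cnot c t h =>
    have hinv : ∀ b : W → Bool, Function.update (Function.update b t (xor (b t) (b c))) t
        (xor (Function.update b t (xor (b t) (b c)) t)
          (Function.update b t (xor (b t) (b c)) c)) = b := by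
      intro b; simp [h]
    refine key _ ?_ fun v => ?_
    · ext a b
      simp only [Matrix.conjTranspose_apply, Gate.mat, Matrix.of_apply]
      have : b = Function.update a t (xor (a t) (a c)) ↔
          a = Function.update b t (xor (b t) (b c)) := by
        constructor <;> rintro rfl <;> rw [hinv]
      simp only [this]
      split_ifs <;> simp
    · funext u
      simp only [cnot_mulVec]
      rw [hinv]

theorem posSemidef_evolve [Fintype W] [DecidableEq W] {rho : Op W} (gs : List (Gate W))
    (h : rho.PosSemidef) : (evolve gs rho).PosSemidef := by
  induction gs generalizing rho with
  | nil => exact h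
  | cons g gs ih => exact ih (h.mul_mul_conjTranspose_same _)

theorem trace_evolve [Fintype W] [DecidableEq W] (gs : List (Gate W)) (rho : Op W) :
    (evolve gs rho).trace = rho.trace := by
  induction gs generalizing rho with
  | nil => rfl
  | cons g gs ih =>
    rw [evolve_cons, ih, Matrix.trace_mul_cycle, Gate.conjTranspose_mul_mat, Matrix.one_mul]

theorem QCircuit.posSemidef_run [Fintype I] [DecidableEq I] (C : QCircuit I O) {rho : Op I}
    (h : rho.PosSemidef) : (C.run rho).PosSemidef := by
  rw [QCircuit.run_eq]
  exact posSemidef_traceOut (posSemidef_evolve _ (posSemidef_tensor h (isState_basisState _).1))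

theorem QCircuit.trace_run [Fintype I] [DecidableEq I] [Fintype O] [DecidableEq O]
    (C : QCircuit I O) (rho : Op I) : (C.run rho).trace = rho.trace := by
  rw [QCircuit.run_eq, trace_traceOut, trace_evolve, trace_tensor, trace_basisState, mul_one]

theorem QCircuit.isState_run [Fintype I] [DecidableEq I] [Fintype O] [DecidableEq O]
    (C : QCircuit I O) {rho : Op I} (h : IsState rho) : IsState (C.run rho) :=
  ⟨C.posSemidef_run h.1, by rw [C.trace_run, h.2]⟩

theorem QCircuit.outputProb_mem_Icc [Fintype I] [DecidableEq I] (C : QCircuit I Unit)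
    {rho : Op I} (h : IsState rho) (b : Bool) : C.outputProb rho b ∈ Set.Icc (0 : ℝ) 1 := by
  have hs := C.isState_run h
  have h0 : ∀ b, 0 ≤ C.outputProb rho b := fun b =>
    (Complex.le_def.1 (hs.1.diag_nonneg (i := fun _ => b))).1
  have h1 : C.outputProb rho false + C.outputProb rho true = 1 := by
    have := congrArg Complex.re hs.2
    rw [Matrix.trace, ← Equiv.sum_comp (Equiv.funUnique Unit Bool).symm] at this
    rw [Fintype.sum_bool, add_comm, Complex.add_re, Complex.one_re] at this
    exact this
  have := h0 false
  have := h0 true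
  cases b <;> constructor <;> linarith

theorem Preparable.isState [Fintype O] [DecidableEq O] {sigma : Op O} {k : ℕ}
    (h : Preparable sigma k) : IsState sigma := by
  obtain ⟨C, -, hC⟩ := h
  have hrun : C.run (basisState fun e : Empty => e.elim) = sigma := hC ()
  exact hrun ▸ C.isState_run (isState_basisState _)

theorem isState_average [Fintype W] [DecidableEq W] (s : Finset ι) (hs : s.Nonempty)
    (rho : ι → Op W) (h : ∀ i ∈ s, IsState (rho i)) :
    IsState ((s.card : ℂ)⁻¹ • ∑ i ∈ s, rho i) := by
  refine ⟨(Matrix.posSemidef_sum _ fun i hi => (h i hi).1).smul (by simp), ?_⟩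
  rw [Matrix.trace_smul, Matrix.trace_sum, Finset.sum_congr rfl fun i hi => (h i hi).2]
  have : (s.card : ℂ) ≠ 0 := by simpa using hs.ne_empty
  simp [this]

theorem sum_trace_afterOutcome [Fintype A] [DecidableEq A] [Fintype B] [DecidableEq B]
    (rho : Op (A ⊕ B)) : ∑ m : A → Bool, (afterOutcome m rho).trace = rho.trace := by
  simp only [Matrix.trace, Matrix.diag]
  rw [sum_sumArrow]
  rfl

end IsState

/-! ### The game with a different encryption map in every round -/

namespace CPAAdversary

open scoped ComplexOrder

/-- Extension of the answers of the first `R` rounds to all rounds. -/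
def extendAnswers {Ct : Type} {R : ℕ} (E : Fin R → (Bool → Bool) → Op Ct) (j : ℕ) :
    (Bool → Bool) → Op Ct :=
  if h : j < R then E ⟨j, h⟩ else 0

theorem extendAnswers_update {Ct : Type} {R : ℕ} (E : Fin R → (Bool → Bool) → Op Ct) (i : Fin R)
    (x : (Bool → Bool) → Op Ct) :
    extendAnswers (Function.update E i x) = Function.update (extendAnswers E) i.1 x := by
  funext j
  by_cases hj : j = i
  · subst hj
    simp [extendAnswers]
  · rw [Function.update_of_ne hj]
    simp only [extendAnswers]
    split_ifs with h
    · rw [Function.update_of_ne]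
      exact fun h' => hj (congrArg Fin.val h')
    · rfl

variable {Ct : Type} [Fintype Ct] [DecidableEq Ct] {q : ℕ}

/-- One round of the game: `A` asks, the queried messages `m` are measured, and `A` receives
`E m`. -/
noncomputable def step (A : CPAAdversary Ct q) (j : ℕ) (E : (Bool → Bool) → Op Ct)
    (rho : Op (Fin A.mem)) : Op (Fin A.mem) :=
  ∑ m : Bool → Bool, (A.recv j).run (tensor (afterOutcome m ((A.ask j).run rho)) (E m))

/-- State of the memory after `j` rounds if the query `m` of round `i` is answered by `E i m`. -/
noncomputable def play (A : CPAAdversary Ct q) (E : ℕ → (Bool → Bool) → Op Ct) :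
    ℕ → Op (Fin A.mem)
  | 0 => basisState fun _ => false
  | j + 1 => A.step j (E j) (A.play E j)

theorem state_eq_play (A : CPAAdversary Ct q) (enc : Bool → Op Ct) (b : Bool) (j : ℕ) :
    A.state enc b j = A.play (fun _ m => enc (m b)) j := by
  induction j with
  | zero => rfl
  | succ j ih => rw [state, play, ih]; rfl

theorem play_congr (A : CPAAdversary Ct q) {E E' : ℕ → (Bool → Bool) → Op Ct} {j : ℕ}
    (h : ∀ i < j, E i = E' i) : A.play E j = A.play E' j := by
  induction j with
  | zero => rfl
  | succ j ih => rw [play, play, ih fun i hi => h i (by omega), h j (by omega)]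

/-- A round is bilinear in the answers and in the state of the memory. -/
noncomputable def stepL (A : CPAAdversary Ct q) (j : ℕ) :
    ((Bool → Bool) → Op Ct) →ₗ[ℂ] Op (Fin A.mem) →ₗ[ℂ] Op (Fin A.mem) :=
  LinearMap.mk₂ ℂ (A.step j)
    (fun E E' rho => by
      simp only [step, Pi.add_apply, tensor_add_right, QCircuit.run_add, Finset.sum_add_distrib])
    (fun c E rho => by
      simp only [step, Pi.smul_apply, tensor_smul_right, QCircuit.run_smul, Finset.smul_sum])
    (fun E rho rho' => by
      have h : ∀ (m : Bool → Bool) (T T' : Op (Bool ⊕ Fin A.mem)),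
          afterOutcome m (T + T') = afterOutcome m T + afterOutcome m T' := fun _ _ _ => rfl
      simp only [step, QCircuit.run_add, h, tensor_add_left, Finset.sum_add_distrib])
    (fun c E rho => by
      have h : ∀ (m : Bool → Bool) (T : Op (Bool ⊕ Fin A.mem)),
          afterOutcome m (c • T) = c • afterOutcome m T := fun _ _ => rfl
      simp only [step, QCircuit.run_smul, h, tensor_smul_left, Finset.smul_sum])

/-- The state of the memory is linear in the answers of each round. -/
theorem exists_play_update (A : CPAAdversary Ct q) (E : ℕ → (Bool → Bool) → Op Ct) {i j : ℕ}
    (hij : i < j) : ∃ f : ((Bool → Bool) → Op Ct) →ₗ[ℂ] Op (Fin A.mem),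
      ∀ x, A.play (Function.update E i x) j = f x := by
  induction j, hij using Nat.le_induction with
  | base =>
    refine ⟨(A.stepL i).flip (A.play E i), fun x => ?_⟩
    rw [play, Function.update_self, A.play_congr (E' := E) fun j hj => by
      rw [Function.update_of_ne (by omega)]]
    rfl
  | succ j hij ih =>
    obtain ⟨f, hf⟩ := ih
    refine ⟨(A.stepL j (E j)).comp f, fun x => ?_⟩
    rw [play, Function.update_of_ne (by omega), hf]
    rfl

/-- The final state of the memory is multilinear in the answers of the rounds. -/
noncomputable def playL (A : CPAAdversary Ct q) :
    MultilinearMap ℂ (fun _ : Fin A.rounds => (Bool → Bool) → Op Ct) (Op (Fin A.mem)) where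
  toFun E := A.play (extendAnswers E) A.rounds
  map_update_add' := by
    intro inst E i x y
    obtain rfl : inst = instDecidableEqFin A.rounds := Subsingleton.elim _ _
    obtain ⟨f, hf⟩ := A.exists_play_update (extendAnswers E) i.2
    simp only [extendAnswers_update]
    simp only [hf, map_add]
  map_update_smul' := by
    intro inst E i c x
    obtain rfl : inst = instDecidableEqFin A.rounds := Subsingleton.elim _ _
    obtain ⟨f, hf⟩ := A.exists_play_update (extendAnswers E) i.2
    simp only [extendAnswers_update]
    simp only [hf, map_smul]

/-- The probability that `A` outputs `1`, as a complex number multilinear in the answers. -/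
noncomputable def acceptL (A : CPAAdversary Ct q) :
    MultilinearMap ℂ (fun _ : Fin A.rounds => (Bool → Bool) → Op Ct) ℂ :=
  (Matrix.entryLinearMap ℂ ℂ (fun _ : Unit => true) (fun _ : Unit => true) ∘ₗ
    A.guess.runL).compMultilinearMap A.playL

/-- The probability that `A` outputs `1` if query `m` of round `j` is answered by `E j m`. -/
noncomputable def accept (A : CPAAdversary Ct q) (E : Fin A.rounds → (Bool → Bool) → Op Ct) : ℝ :=
  (A.acceptL E).re

theorem outputProb_play (A : CPAAdversary Ct q) (E : ℕ → (Bool → Bool) → Op Ct) :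
    A.guess.outputProb (A.play E A.rounds) true = A.accept fun j => E j := by
  have : A.play E A.rounds = A.playL fun j => E j :=
    A.play_congr fun i hi => by simp [extendAnswers, hi]
  rw [this]
  rfl

theorem isState_step (A : CPAAdversary Ct q) (j : ℕ) {E : (Bool → Bool) → Op Ct}
    (hE : ∀ m, IsState (E m)) {rho : Op (Fin A.mem)} (h : IsState rho) :
    IsState (A.step j E rho) := by
  have hask := (A.ask j).isState_run h
  refine ⟨Matrix.posSemidef_sum _ fun m _ => (A.recv j).posSemidef_run
    (posSemidef_tensor (hask.1.submatrix _) (hE m).1), ?_⟩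
  rw [step, Matrix.trace_sum]
  simp only [QCircuit.trace_run, trace_tensor, (hE _).2, mul_one, sum_trace_afterOutcome]
  exact h.2

theorem isState_play (A : CPAAdversary Ct q) {E : ℕ → (Bool → Bool) → Op Ct}
    (hE : ∀ i m, IsState (E i m)) (j : ℕ) : IsState (A.play E j) := by
  induction j with
  | zero => exact isState_basisState _
  | succ j ih => exact A.isState_step j (hE j) ih

end CPAAdversary

/-! ### The reduction: playing the game with states received from outside -/

section Reduction

variable {ι : Type*} {I J N T W : Type}

/-- The product of the states `(r i, other i)`, with `phi` in place of `other i0`. -/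
noncomputable def plugState [Fintype J] [DecidableEq J] [Fintype T] [DecidableEq T] (i0 : J)
    (r : J → T → Bool) (other : J → Op N) (phi : Op N) : Op (J × (T ⊕ N)) :=
  tensorPi fun i => tensor (basisState (r i)) (Function.update other i0 phi i)

/-- The other factors are fixed, so a circuit can prepare them around the given state `phi`. -/
theorem converts_plugState [Fintype J] [DecidableEq J] [Fintype T] [DecidableEq T] [Fintype N]
    [DecidableEq N] (i0 : J) (r : J → T → Bool) (other : J → Op N) (k : ℕ)
    (h : ∀ i, Preparable (other i) k) :
    Converts (fun phi : Op N => phi) (plugState i0 r other)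
      (7 * Fintype.card T + Fintype.card J * (7 * Fintype.card T + k)) := by
  let e : Option {j // j ≠ i0} ≃ J := Equiv.optionSubtypeNe i0
  have h1 : Converts (fun phi : Op N => phi) (fun phi => tensor (basisState (r i0)) phi)
      (7 * Fintype.card T) :=
    (Converts.tensor_basisState _ _).trans (Converts.swap _ _)
  have h2 := (preparable_tensorPi (fun j : {j // j ≠ i0} =>
    tensor (basisState (r j)) (other j)) (7 * Fintype.card T + k)
      fun j => (preparable_basisState _).tensor (h _)).mono
        (Nat.mul_le_mul_right _ (Fintype.card_subtype_le _))
  refine ((h1.trans (h2.attach _)).trans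
    (Converts.traceOut (splitFactor e).symm.toEmbedding _)).congr fun phi => ?_
  rw [plugState, ← traceOut_tensor_tensorPi e]
  congr 1
  have he : e none = i0 := by simp [e]
  have he' : ∀ j, e (some j) = j.1 := fun j => by simp [e]
  simp only [he, he', Function.update_self]
  congr 2
  funext j
  rw [Function.update_of_ne j.2]

/-- The pairing of the factors of a product register along `idx`. -/
def pairFactors (idx : I × Bool ≃ J) : I × (W ⊕ W) ≃ J × W :=
  (((Equiv.refl I).prodCongr (Equiv.boolProdEquivSum W).symm).trans
    (Equiv.prodAssoc I Bool W).symm).trans (idx.prodCongr (Equiv.refl W))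

theorem traceOut_pairFactors [Fintype I] [Fintype J] [Fintype W] (idx : I × Bool ≃ J)
    (rho : J → Op W) :
    traceOut (pairFactors idx).toEmbedding (tensorPi rho) =
      tensorPi fun i => tensor (rho (idx (i, false))) (rho (idx (i, true))) := by
  rw [← traceOut_equiv_symm_apply (pairFactors idx)
    (tensorPi fun i => tensor (rho (idx (i, false))) (rho (idx (i, true))))]
  congr 1
  ext u v
  rw [traceOut_equiv, tensorPi_apply, tensorPi_apply, ← Equiv.prod_comp idx,
    Fintype.prod_prod_type]
  refine Finset.prod_congr rfl fun i _ => ?_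
  rw [Fintype.prod_bool, mul_comm]
  rfl

namespace CPAAdversary

variable {Ct : Type} [Fintype Ct] [DecidableEq Ct] {q : ℕ}

/-- One round of the game, the answer being made by a circuit from one of two given states, chosen
by the queried message with index `b`. -/
theorem converts_step [Fintype N] [DecidableEq N] (A : CPAAdversary Ct q) (j : ℕ) (b c : Bool)
    (ct : Op N → Op Ct) (k : ℕ) (hct : Converts (fun phi => phi) ct k)
    (rho : ι → Op (Fin A.mem)) (phi : ι → Bool → Op N) (hphi : ∀ i s, (phi i s).trace = 1) :
    Converts (fun i => tensor (rho i) (tensor (phi i false) (phi i true)))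
      (fun i => A.step j (fun m => ct (phi i (xor (m b) c))) (rho i))
      ((A.ask j).size + 39 * Fintype.card N + k + (A.recv j).size) := by
  have h1 := (Converts.run (A.ask j) rho).tensor_right
    (fun i => tensor (phi i false) (phi i true))
  have h2 := Converts.select b (fun i => (A.ask j).run (rho i)) phi hphi c
  -- The rest of the round is known to be a circuit for product states; the state before it is a sum
  -- of such states over the outcomes `m`.
  have h3 : Converts (fun p : Op (Fin A.mem) × Op N => tensor p.1 p.2)
      (fun p => (A.recv j).run (tensor p.1 (ct p.2)))
      (k + ((A.recv j).anc + (A.recv j).gates.length)) :=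
    ((hct.comap Prod.snd).tensor_left _).trans (Converts.run _ _)
  have h4 := h3.sum Finset.univ fun (i : ι) (m : Bool → Bool) =>
    (afterOutcome m ((A.ask j).run (rho i)), phi i (xor (m b) c))
  refine ((h1.trans h2).trans h4).mono ?_
  simp only [QCircuit.size]
  omega

/-- Several rounds of the game, for which pairs of states are given. -/
theorem converts_play [Fintype N] [DecidableEq N] (A : CPAAdversary Ct q) (b : Bool)
    (c : ℕ → Bool) (ct : ℕ → Op N → Op Ct) (k : ℕ)
    (phi : ι → ℕ → Bool → Op N) (hphi : ∀ i j s, (phi i j s).trace = 1) (l j : ℕ)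
    (hct : ∀ p < j + l, Converts (fun phi => phi) (ct p) k) :
    Converts (fun i => tensor (A.play (fun j m => ct j (phi i j (xor (m b) (c j)))) j)
        (tensorPi fun p : Fin l => tensor (phi i (j + p) false) (phi i (j + p) true)))
      (fun i => A.play (fun j m => ct j (phi i j (xor (m b) (c j)))) (j + l))
      (∑ p ∈ Finset.range l, ((A.ask (j + p)).size + 39 * Fintype.card N + k +
        (A.recv (j + p)).size)) := by
  induction l generalizing j with
  | zero =>
    refine ((Converts.traceOut Function.Embedding.inl _).mono (by simp)).congr fun i => ?_
    rw [traceOut_inl_tensor, add_zero]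
    simp [Matrix.trace, tensorPi_apply]
  | succ l ih =>
    have h1 := (Converts.traceOut (splitFactor (finSuccEquiv l).symm).toEmbedding
      fun i => tensorPi fun p : Fin (l + 1) =>
        tensor (phi i (j + p) false) (phi i (j + p) true)).tensor_left
      (fun i => A.play (fun j m => ct j (phi i j (xor (m b) (c j)))) j)
    simp only [traceOut_tensorPi, finSuccEquiv_symm_none, finSuccEquiv_symm_some] at h1
    have h2 := (A.converts_step j b (c j) (ct j) k (hct j (by omega))
      (fun i => A.play (fun j m => ct j (phi i j (xor (m b) (c j)))) j) (fun i => phi i j)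
      (fun i => hphi i j)).tensor_right (fun i => tensorPi fun p : Fin l =>
        tensor (phi i (j + 1 + p) false) (phi i (j + 1 + p) true))
    have h3 := ih (j + 1) fun p hp => hct p (by omega)
    have h1' : Converts _ (fun i => tensor (A.play (fun j m => ct j (phi i j (xor (m b) (c j)))) j)
        (tensor (tensor (phi i j false) (phi i j true)) (tensorPi fun p : Fin l =>
        tensor (phi i (j + 1 + p) false) (phi i (j + 1 + p) true)))) 0 := h1.congr fun i => by
      congr 3
      funext p
      rw [Fin.val_succ, ← add_assoc, add_right_comm]
    have := ((h1'.trans (Converts.assoc _ _ _)).trans h2).trans h3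
    refine (this.mono (le_of_eq ?_)).congr fun i => by rw [add_right_comm, add_assoc]
    rw [Finset.sum_range_succ']
    simp only [add_zero, zero_add, add_assoc, add_comm, add_left_comm]

end CPAAdversary

end Reduction

section Distinguisher

variable {J N T : Type}

theorem trace_prfsFactor {d n : ℕ} (x : Fin d → Bool) (phi : Op (Fin n)) :
    (tensor (basisState x) (tensorPi fun _ : Fin 1 => phi)).trace = phi.trace := by
  have h : tensorPi (fun _ : Fin 1 => phi) =
      traceOut (Equiv.uniqueProd (Fin n) (Fin 1)).toEmbedding phi := by
    ext u v
    rw [traceOut_equiv, tensorPi_apply, Fin.prod_univ_one]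
    rfl
  rw [trace_tensor, trace_basisState, one_mul, h, trace_traceOut]

/-- The qubits of the single copy of the state in an entry of a distinguisher's input. -/
def copyQubits (d n : ℕ) : Fin n ↪ Fin d ⊕ Fin 1 × Fin n :=
  (Equiv.uniqueProd (Fin n) (Fin 1)).symm.toEmbedding.trans Function.Embedding.inr

theorem traceOut_copyQubits {d n : ℕ} (x : Fin d → Bool) (phi : Op (Fin n)) :
    traceOut (copyQubits d n) (tensor (basisState x) (tensorPi fun _ : Fin 1 => phi)) = phi := by
  rw [copyQubits, ← traceOut_traceOut, traceOut_inr_tensor, trace_basisState, one_smul]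
  ext u v
  rw [traceOut_equiv, tensorPi_apply, Fin.prod_univ_one]
  rfl

/-- The reduction: a distinguisher plays the game with challenge bit `b`, taking the state of
factor `i0` of the answer in round `j` from its own input: the entry `idx (j, m b ⊕ c j)`. -/
theorem CPAAdversary.exists_distinguisher {l t d n s q : ℕ}
    (A : CPAAdversary (Fin l × (Fin t ⊕ Fin n)) q) (b : Bool) (i0 : Fin l)
    (r : Fin A.rounds → Fin l → Fin t → Bool) (other : Fin A.rounds → Fin l → Op (Fin n))
    (c : Fin A.rounds → Bool) (k : ℕ) (hother : ∀ j i, Preparable (other j i) k)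
    (idx : Fin A.rounds × Bool ≃ Fin s) (x : Fin s → Fin d → Bool) :
    ∃ B : QCircuit (Fin s × (Fin d ⊕ Fin 1 × Fin n)) Unit,
      B.size ≤ s * (d + n) + 2 * A.size + A.rounds * (39 * (d + n) + (7 * t + l * (7 * t + k))) ∧
      ∀ phi : Fin s → Op (Fin n), (∀ p, (phi p).trace = 1) →
        B.outputProb (prfsSample 1 x phi) true = A.accept fun j m =>
          plugState i0 (r j) (other j) (phi (idx (j, xor (m b) (c j)))) := by
  let ι := {phi : Fin s → Op (Fin n) // ∀ p, (phi p).trace = 1}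
  let entry : ι → Fin s → Op (Fin d ⊕ Fin 1 × Fin n) := fun phi p =>
    tensor (basisState (x p)) (tensorPi fun _ : Fin 1 => phi.1 p)
  have hentry : ∀ phi p, (entry phi p).trace = 1 := fun phi p => by
    rw [trace_prfsFactor, phi.2]
  -- The values for rounds that are not played are irrelevant, except that `Phi` has trace one.
  let Phi : ι → ℕ → Bool → Op (Fin d ⊕ Fin 1 × Fin n) := fun phi j β =>
    if h : j < A.rounds then entry phi (idx (⟨j, h⟩, β)) else basisState fun _ => false
  have hPhi : ∀ phi j β, (Phi phi j β).trace = 1 := fun phi j β => by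
    by_cases h : j < A.rounds
    · simp [Phi, h, hentry]
    · simp [Phi, h, trace_basisState]
  let c' : ℕ → Bool := fun j => if h : j < A.rounds then c ⟨j, h⟩ else false
  let ct : ℕ → Op (Fin d ⊕ Fin 1 × Fin n) → Op (Fin l × (Fin t ⊕ Fin n)) := fun j T =>
    if h : j < A.rounds then
      plugState i0 (r ⟨j, h⟩) (other ⟨j, h⟩) (traceOut (copyQubits d n) T) else 0
  have hct : ∀ j < 0 + A.rounds, Converts (fun T => T) (ct j) (7 * t + l * (7 * t + k)) := by
    intro j hj
    have hj : j < A.rounds := by omega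
    have h := (converts_plugState i0 (r ⟨j, hj⟩) (other ⟨j, hj⟩) k (hother _)).comap
      (fun T : Op (Fin d ⊕ Fin 1 × Fin n) => traceOut (copyQubits d n) T)
    refine (((Converts.traceOut (copyQubits d n) fun T => T).trans h).mono (by simp)).congr ?_
    intro T
    simp [ct, hj]
  have hplay := A.converts_play b c' ct _ Phi hPhi A.rounds 0 hct
  have hstart : Converts (fun phi : ι => prfsSample 1 x phi.1)
      (fun phi => tensor (A.play (fun j m => ct j (Phi phi j (xor (m b) (c' j)))) 0)
        (tensorPi fun p : Fin A.rounds =>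
          tensor (Phi phi (0 + p) false) (Phi phi (0 + p) true))) A.mem := by
    refine ((((Converts.traceOut (pairFactors idx).toEmbedding _).trans
      (Converts.tensor_zero (B := Fin A.mem) _)).trans (Converts.swap _ _)).mono
        (by simp)).congr fun phi => ?_
    rw [show prfsSample 1 x phi.1 = tensorPi (entry phi) from rfl, traceOut_pairFactors]
    simp only [Phi, zero_add, Fin.is_lt, dif_pos, Fin.eta]
    rfl
  obtain ⟨B, hB, hrun⟩ := (hstart.trans hplay).trans (Converts.run A.guess _)
  refine ⟨B, ?_, fun phi hphi => ?_⟩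
  · simp only [Finset.sum_add_distrib, zero_add, Finset.sum_const, Finset.card_range,
      smul_eq_mul] at hB
    have hAsize : A.size = (∑ j ∈ Finset.range A.rounds, (A.ask j).size +
        ∑ j ∈ Finset.range A.rounds, (A.recv j).size) + A.guess.size := by
      rw [CPAAdversary.size, Finset.sum_add_distrib]
    have hguess : A.guess.size = A.mem + A.guess.anc + A.guess.gates.length := by
      simp [QCircuit.size]
    rw [QCircuit.size]
    simp only [Fintype.card_prod, Fintype.card_sum, Fintype.card_fin, one_mul] at hB ⊢
    simp only [mul_add A.rounds] at hB ⊢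
    omega
  · have h := hrun ⟨phi, hphi⟩
    have hout : B.outputProb (prfsSample 1 x phi) true = A.guess.outputProb (A.play
        (fun j m => ct j (Phi ⟨phi, hphi⟩ j (xor (m b) (c' j)))) (0 + A.rounds)) true := by
      simp only [QCircuit.outputProb]
      rw [h]
    rw [hout, zero_add, CPAAdversary.outputProb_play]
    congr 1
    funext j m
    simp only [ct, Phi, c', Fin.is_lt, dif_pos, Fin.eta, entry, traceOut_copyQubits]

end Distinguisher

/-! ### Haar-random states hide which of them are used -/

section Haar

/-- Only finiteness matters below: averages for the two challenge bits are compared with each other,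
so the total mass plays no role. -/
instance isFiniteMeasure_haarState (n : ℕ) : IsFiniteMeasure (haarState n) := by
  refine ⟨lt_of_le_of_lt ?_ ENNReal.one_lt_top⟩
  rw [haarState, Measure.smul_apply, smul_eq_mul]
  exact ENNReal.inv_mul_le_one _

theorem trace_pureState_sphere {n : ℕ}
    (psi : Metric.sphere (0 : EuclideanSpace ℂ (Fin n → Bool)) 1) :
    (pureState fun a => psi.1 a).trace = 1 := by
  have h : ‖psi.1‖ = 1 := by simp
  rw [EuclideanSpace.norm_eq, Real.sqrt_eq_one] at h
  have h' : (pureState fun a => psi.1 a).trace = ((∑ a, ‖psi.1 a‖ ^ 2 : ℝ) : ℂ) := by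
    rw [Matrix.trace, Complex.ofReal_sum]
    refine Finset.sum_congr rfl fun a _ => ?_
    simp [pureState, Matrix.vecMulVec_apply, Complex.mul_conj, Complex.normSq_eq_norm_sq]
  rw [h', h, Complex.ofReal_one]

variable {X : Type*} [TopologicalSpace X]

theorem continuous_tensor {A B : Type} {f : X → Op A} {g : X → Op B} (hf : Continuous f)
    (hg : Continuous g) : Continuous fun x => tensor (f x) (g x) := by
  refine continuous_matrix fun u v => ?_
  simp only [tensor_apply]
  exact (hf.matrix_elem _ _).mul (hg.matrix_elem _ _)

theorem continuous_tensorPi {I W : Type} [Fintype I] {f : X → I → Op W}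
    (hf : ∀ i, Continuous fun x => f x i) : Continuous fun x => tensorPi (f x) := by
  refine continuous_matrix fun u v => ?_
  simp only [tensorPi_apply]
  exact continuous_finsetProd _ fun i _ => (hf i).matrix_elem _ _

theorem QCircuit.continuous_run {I O : Type} [Fintype I] [DecidableEq I] [Fintype O]
    (C : QCircuit I O) {f : X → Op I} (hf : Continuous f) : Continuous fun x => C.run (f x) :=
  (LinearMap.continuous_of_finiteDimensional C.runL).comp hf

theorem CPAAdversary.continuous_play {Ct : Type} [Fintype Ct] [DecidableEq Ct] {q : ℕ}
    (A : CPAAdversary Ct q) {E : X → ℕ → (Bool → Bool) → Op Ct}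
    (hE : ∀ j m, Continuous fun x => E x j m) (j : ℕ) : Continuous fun x => A.play (E x) j := by
  induction j with
  | zero => exact continuous_const
  | succ j ih =>
    change Continuous fun x => ∑ m : Bool → Bool, (A.recv j).run
      (tensor (afterOutcome m ((A.ask j).run (A.play (E x) j))) (E x j m))
    refine continuous_finsetSum _ fun m _ => (A.recv j).continuous_run ?_
    refine continuous_tensor ?_ (hE j m)
    exact ((A.ask j).continuous_run ih).matrix_submatrix _ _

theorem CPAAdversary.continuous_accept {Ct : Type} [Fintype Ct] [DecidableEq Ct] {q : ℕ}
    (A : CPAAdversary Ct q) {E : X → Fin A.rounds → (Bool → Bool) → Op Ct}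
    (hE : ∀ j m, Continuous fun x => E x j m) : Continuous fun x => A.accept (E x) := by
  have h : Continuous fun x => A.play (extendAnswers (E x)) A.rounds := by
    refine A.continuous_play (fun j m => ?_) _
    by_cases hj : j < A.rounds
    · simpa [extendAnswers, hj] using hE ⟨j, hj⟩ m
    · simpa [extendAnswers, hj] using continuous_const
  exact Complex.continuous_re.comp ((A.guess.continuous_run h).matrix_elem _ _)

theorem continuous_pureState {n : ℕ} :
    Continuous fun psi : Metric.sphere (0 : EuclideanSpace ℂ (Fin n → Bool)) 1 =>
      pureState fun a => psi.1 a := by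
  refine continuous_matrix fun u v => ?_
  simp only [pureState, Matrix.vecMulVec_apply, Pi.star_apply]
  fun_prop

/-- The acceptance probability is the sum, over the possible transcripts of queries, of the
contributions of these transcripts. -/
theorem CPAAdversary.accept_eq_sum {Ct : Type} [Fintype Ct] [DecidableEq Ct] {q : ℕ}
    (A : CPAAdversary Ct q) (E : Fin A.rounds → (Bool → Bool) → Op Ct) :
    A.accept E = ∑ tau : Fin A.rounds → Bool → Bool,
      A.accept fun j => Pi.single (tau j) (E j (tau j)) := by
  have h : E = fun j => ∑ m, Pi.single m (E j m) := by
    funext j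
    exact (Finset.univ_sum_single (E j)).symm
  simp only [accept]
  conv_lhs => rw [h]
  rw [MultilinearMap.map_sum, Complex.re_sum]

theorem integral_pi_comp_equiv {I Y : Type*} [Fintype I] [MeasurableSpace Y] (mu : Measure Y)
    [SigmaFinite mu] (e : I ≃ I) (f : (I → Y) → ℝ) :
    ∫ psi, f (fun i => psi (e i)) ∂(Measure.pi fun _ => mu) =
      ∫ psi, f psi ∂(Measure.pi fun _ => mu) := by
  have h := (measurePreserving_piCongrLeft (fun _ : I => mu) e.symm).integral_comp' f
  rw [← h]
  congr 1
  funext psi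
  congr 1
  funext i
  have := MeasurableEquiv.piCongrLeft_apply_apply (β := fun _ : I => Y) e.symm psi (e i)
  rw [← this, e.symm_apply_apply]

/-- If the answers are made from independent states with the same distribution, then it does not
matter for the average which state is used for which message: for each transcript, a permutation of
the states exchanges the two choices. -/
theorem CPAAdversary.integral_accept_eq {Ct I Y : Type} [Fintype Ct] [DecidableEq Ct] {q : ℕ}
    [Fintype I] [TopologicalSpace Y] [CompactSpace Y] [MeasurableSpace Y] [BorelSpace Y]
    [SecondCountableTopology Y]
    (mu : Measure Y) [IsFiniteMeasure mu] (A : CPAAdversary Ct q) (idx : Fin A.rounds × Bool ≃ I)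
    (c : Fin A.rounds → Bool) (F : Fin A.rounds → Y → Op Ct) (hF : ∀ j, Continuous (F j)) :
    ∫ psi : I → Y, A.accept (fun j m => F j (psi (idx (j, xor (m false) (c j)))))
        ∂(Measure.pi fun _ => mu) =
      ∫ psi : I → Y, A.accept (fun j m => F j (psi (idx (j, xor (m true) (c j)))))
        ∂(Measure.pi fun _ => mu) := by
  have hint : ∀ (b : Bool) (tau : Fin A.rounds → Bool → Bool), Integrable (fun psi : I → Y =>
      A.accept fun j => Pi.single (tau j) (F j (psi (idx (j, xor (tau j b) (c j))))))
      (Measure.pi fun _ => mu) := by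
    intro b tau
    have hcont : Continuous fun psi : I → Y =>
        A.accept fun j => Pi.single (tau j) (F j (psi (idx (j, xor (tau j b) (c j))))) := by
      refine A.continuous_accept fun j m => ?_
      by_cases hm : m = tau j
      · subst hm
        simpa [Function.comp_def] using
          (hF j).comp (continuous_apply (idx (j, xor (tau j b) (c j))))
      · simpa [hm] using continuous_const
    exact hcont.integrable_of_hasCompactSupport (HasCompactSupport.of_compactSpace _)
  have hsum : ∀ b : Bool,
      ∫ psi : I → Y, A.accept (fun j m => F j (psi (idx (j, xor (m b) (c j)))))
        ∂(Measure.pi fun _ => mu) =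
      ∑ tau : Fin A.rounds → Bool → Bool, ∫ psi : I → Y,
        A.accept (fun j => Pi.single (tau j) (F j (psi (idx (j, xor (tau j b) (c j))))))
          ∂(Measure.pi fun _ => mu) := by
    intro b
    rw [← integral_finsetSum _ fun tau _ => hint b tau]
    congr 1
    funext psi
    exact A.accept_eq_sum _
  rw [hsum, hsum]
  refine Finset.sum_congr rfl fun tau _ => ?_
  obtain ⟨e, he⟩ : ∃ e : I ≃ I, ∀ j,
      e (idx (j, xor (tau j false) (c j))) = idx (j, xor (tau j true) (c j)) := by
    have hflip : Function.Involutive fun p : Fin A.rounds × Bool =>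
        (p.1, xor p.2 (xor (tau p.1 false) (tau p.1 true))) := fun p => by simp
    refine ⟨(idx.symm.trans hflip.toPerm).trans idx, fun j => ?_⟩
    rw [Equiv.trans_apply, Equiv.trans_apply, Equiv.symm_apply_apply]
    refine congrArg idx (Prod.ext rfl ?_)
    change xor (xor (tau j false) (c j)) (xor (tau j false) (tau j true)) = xor (tau j true) (c j)
    generalize tau j false = x
    generalize tau j true = y
    generalize c j = z
    revert x y z
    decide
  refine (integral_pi_comp_equiv mu e fun psi => A.accept fun j =>
    Pi.single (tau j) (F j (psi (idx (j, xor (tau j false) (c j)))))).symm.trans ?_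
  simp only [he]

end Haar

/-! ### Averages over tags, shares and keys -/

section Averages

open scoped BigOperators

/-- The acceptance probability against averaged answers is the average over independent choices for
all rounds. -/
theorem CPAAdversary.accept_average {Ct Ω : Type} [Fintype Ct] [DecidableEq Ct] [Fintype Ω]
    {q : ℕ} (A : CPAAdversary Ct q) (E : Fin A.rounds → Ω → (Bool → Bool) → Op Ct) :
    A.accept (fun j m => (Fintype.card Ω : ℂ)⁻¹ • ∑ w, E j w m) =
      𝔼 w : Fin A.rounds → Ω, A.accept fun j => E j (w j) := by
  have h : (fun j m => (Fintype.card Ω : ℂ)⁻¹ • ∑ w, E j w m) =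
      fun j => (Fintype.card Ω : ℂ)⁻¹ • ∑ w, E j w := by
    funext j m
    simp
  have hc : ∏ _i : Fin A.rounds, (Fintype.card Ω : ℂ)⁻¹ =
      (((Fintype.card (Fin A.rounds → Ω) : ℝ)⁻¹ : ℝ) : ℂ) := by
    simp
  rw [h, accept, MultilinearMap.map_smul_univ A.acceptL (fun _ => (Fintype.card Ω : ℂ)⁻¹)
    (fun j => ∑ w, E j w), MultilinearMap.map_sum, hc, smul_eq_mul, Complex.re_ofReal_mul,
    Complex.re_sum, Fintype.expect_eq_sum_div_card, inv_mul_eq_div]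
  rfl

/-- Resampling one coordinate of a uniform family does not change averages. -/
theorem expect_eq_expect_update {J Y : Type*} [Fintype J] [DecidableEq J] [Fintype Y] [Nonempty Y]
    (i0 : J) (F : (J → Y) → ℝ) :
    𝔼 k : J → Y, F k = 𝔼 k : J → Y, 𝔼 y : Y, F (Function.update k i0 y) := by
  -- Exchanging `k i0` with the fresh value `y` is an involution.
  have hinv : Function.Involutive fun p : (J → Y) × Y => (Function.update p.1 i0 p.2, p.1 i0) :=
    fun p => by simp
  calc 𝔼 k : J → Y, F k = 𝔼 k : J → Y, 𝔼 _y : Y, F k := by simp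
    _ = 𝔼 p : (J → Y) × Y, F p.1 := (Finset.expect_product' _ _ fun k _ => F k).symm
    _ = 𝔼 p : (J → Y) × Y, F (Function.update p.1 i0 p.2) :=
      (Fintype.expect_equiv hinv.toPerm (fun p => F (Function.update p.1 i0 p.2))
        (fun p => F p.1) fun _ => rfl).symm
    _ = _ := Finset.expect_product' _ _ fun k y => F (Function.update k i0 y)

theorem xorAll_succ {l : ℕ} (s : Fin (l + 1) → Bool) :
    xorAll s = xor (s 0) (xorAll fun i => s i.succ) := by
  simp [xorAll, List.ofFn_succ]

theorem xorAll_update {l : ℕ} (s : Fin l → Bool) (i : Fin l) (v : Bool) :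
    xorAll (Function.update s i v) = xor v (xor (s i) (xorAll s)) := by
  induction l with
  | zero => exact i.elim0
  | succ l ih =>
    rw [xorAll_succ, xorAll_succ s]
    refine Fin.cases ?_ (fun i => ?_) i
    · have : (fun j : Fin l => Function.update s 0 v j.succ) = fun j => s j.succ := by
        funext j; simp
      rw [this, Function.update_self]
      simp
    · have : (fun j : Fin l => Function.update s i.succ v j.succ) =
          Function.update (fun j => s j.succ) i v := by
        funext j
        simp [Function.update_apply]
      rw [this, ih, Function.update_of_ne (Fin.succ_ne_zero i).symm]
      cases s 0 <;> cases v <;> simp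

/-- The family `s` with coordinate `i0` changed such that the exclusive or becomes `m`. -/
def fixShare {l : ℕ} (i0 : Fin l) (s : Fin l → Bool) (m : Bool) : Fin l → Bool :=
  Function.update s i0 (xor m (xor (s i0) (xorAll s)))

theorem sum_fixShare {l : ℕ} {M : Type*} [AddCommMonoid M] (i0 : Fin l) (m : Bool)
    (F : (Fin l → Bool) → M) :
    ∑ s, F (fixShare i0 s m) =
      2 • ∑ s ∈ Finset.univ.filter (fun s : Fin l → Bool => xorAll s = m), F s := by
  have h1 : ∀ s : Fin l → Bool, xorAll s = m → fixShare i0 s m = s := by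
    rintro s rfl
    have h : xor (xorAll s) (xor (s i0) (xorAll s)) = s i0 := by
      cases xorAll s <;> cases s i0 <;> rfl
    rw [fixShare, h, Function.update_eq_self]
  have h2 : ∀ s : Fin l → Bool, xorAll s ≠ m → fixShare i0 s m = Function.update s i0 (!s i0) := by
    intro s hs
    rw [fixShare]
    congr 1
    cases hx : xorAll s <;> cases m <;> simp_all
  rw [two_nsmul, ← Finset.sum_filter_add_sum_filter_not Finset.univ fun s => xorAll s = m]
  congr 1
  · refine Finset.sum_congr rfl fun s hs => ?_
    rw [h1 s (Finset.mem_filter.1 hs).2]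
  · refine Finset.sum_bij' (fun s _ => Function.update s i0 (!s i0))
      (fun s _ => Function.update s i0 (!s i0)) ?_ ?_ ?_ ?_ ?_
    · intro s hs
      simp only [Finset.mem_filter, Finset.mem_univ, true_and] at hs ⊢
      rw [xorAll_update]
      revert hs
      cases xorAll s <;> cases m <;> cases s i0 <;> simp
    · intro s hs
      simp only [Finset.mem_filter, Finset.mem_univ, true_and] at hs ⊢
      rw [xorAll_update]
      revert hs
      cases xorAll s <;> cases m <;> cases s i0 <;> simp
    · intro s _; simp
    · intro s _; simp
    · intro s hs
      rw [h2 s (by simpa using hs)]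

/-- Shares with exclusive or `m` may be sampled by sampling all shares freely and then correcting
the share `i0`. -/
theorem average_filter_xorAll {l : ℕ} {M : Type*} [AddCommGroup M] [Module ℂ M] (i0 : Fin l)
    (m : Bool) (F : (Fin l → Bool) → M) :
    ((Finset.univ.filter fun s : Fin l → Bool => xorAll s = m).card : ℂ)⁻¹ •
        ∑ s ∈ Finset.univ.filter (fun s : Fin l → Bool => xorAll s = m), F s =
      (Fintype.card (Fin l → Bool) : ℂ)⁻¹ • ∑ s, F (fixShare i0 s m) := by
  have hcard := sum_fixShare i0 m fun _ => (1 : ℕ)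
  simp only [Finset.sum_const, smul_eq_mul, mul_one, Finset.card_univ] at hcard
  rw [sum_fixShare, hcard, ← Nat.cast_smul_eq_nsmul ℂ, smul_smul]
  congr 1
  push_cast
  rw [mul_inv]
  field_simp

theorem filter_xorAll_nonempty {l : ℕ} (hl : 0 < l) (m : Bool) :
    (Finset.univ.filter fun s : Fin l → Bool => xorAll s = m).Nonempty := by
  refine ⟨fixShare ⟨0, hl⟩ (fun _ => false) m, ?_⟩
  simp only [Finset.mem_filter, Finset.mem_univ, true_and, fixShare, xorAll_update]
  generalize xorAll (fun _ : Fin l => false) = x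
  cases x <;> cases m <;> rfl

end Averages

/-! ### Collisions among tags -/

section Birthday

open scoped BigOperators

/-- The birthday bound. -/
theorem pow_mul_le_descFactorial (N R : ℕ) (hN : 0 < N) :
    (N : ℝ) ^ R * (1 - R * (R - 1) / (2 * N)) ≤ N.descFactorial R := by
  have hN' : (0 : ℝ) < N := by exact_mod_cast hN
  induction R with
  | zero => simp
  | succ R ih =>
    have h1 : (N : ℝ) - R ≤ ((N - R : ℕ) : ℝ) := by
      rw [sub_le_iff_le_add]
      exact_mod_cast le_tsub_add
    have h2 : ((N.descFactorial R : ℕ) : ℝ) ≤ (N : ℝ) ^ R := by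
      exact_mod_cast Nat.descFactorial_le_pow N R
    rw [Nat.descFactorial_succ]
    push_cast
    calc (N : ℝ) ^ (R + 1) * (1 - (R + 1) * (R + 1 - 1) / (2 * N))
        = N * ((N : ℝ) ^ R * (1 - R * (R - 1) / (2 * N))) - R * (N : ℝ) ^ R := by
          field_simp
          ring
      _ ≤ N * (N.descFactorial R : ℝ) - R * (N.descFactorial R : ℝ) := by gcongr
      _ = (N - R) * (N.descFactorial R : ℝ) := by ring
      _ ≤ _ := by gcongr

open Classical in
theorem expect_not_injective_le {T : Type*} [Fintype T] [Nonempty T] (R : ℕ)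
    (h : R * R ≤ Fintype.card T) :
    𝔼 f : Fin R → T, (if Function.Injective f then (0 : ℝ) else 1) ≤ 1 / 2 := by
  have hN : 0 < Fintype.card T := Fintype.card_pos
  have hN' : (0 : ℝ) < Fintype.card T := by exact_mod_cast hN
  have hinj : ∑ f : Fin R → T, (if Function.Injective f then (1 : ℝ) else 0) =
      (Fintype.card T).descFactorial R := by
    rw [Finset.sum_boole, ← Fintype.card_subtype,
      Fintype.card_congr (Equiv.subtypeInjectiveEquivEmbedding (Fin R) T),
      Fintype.card_embedding_eq, Fintype.card_fin]
  have hsum : ∑ f : Fin R → T, (if Function.Injective f then (0 : ℝ) else 1) =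
      (Fintype.card T : ℝ) ^ R - (Fintype.card T).descFactorial R := by
    rw [← hinj, eq_sub_iff_add_eq, ← Finset.sum_add_distrib]
    have : ∀ f : Fin R → T, (if Function.Injective f then (0 : ℝ) else 1) +
        (if Function.Injective f then (1 : ℝ) else 0) = 1 := fun f => by split_ifs <;> norm_num
    simp [this]
  have hb := pow_mul_le_descFactorial (Fintype.card T) R hN
  have hR : (R : ℝ) * (R - 1) / (2 * Fintype.card T) ≤ 1 / 2 := by
    rw [div_le_div_iff₀ (by positivity) (by norm_num)]
    have h' : (R : ℝ) * R ≤ Fintype.card T := by exact_mod_cast h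
    have : (0 : ℝ) ≤ R := Nat.cast_nonneg R
    nlinarith
  have hpow : (0 : ℝ) < (Fintype.card T : ℝ) ^ R := by positivity
  rw [Fintype.expect_eq_sum_div_card, hsum, Fintype.card_fun, Fintype.card_fin, Nat.cast_pow,
    div_le_iff₀ hpow]
  nlinarith [mul_le_mul_of_nonneg_left hR hpow.le]

open Classical in
/-- With `l` independent columns of tags, a collision in every column is exponentially unlikely. -/
theorem expect_forall_not_injective_le {T : Type*} [Fintype T] [Nonempty T] (R l : ℕ)
    (h : R * R ≤ Fintype.card T) :
    𝔼 r : Fin R → Fin l → T,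
      (if ∀ i, ¬ Function.Injective fun j => r j i then (1 : ℝ) else 0) ≤ (1 / 2) ^ l := by
  have hprod : ∀ r : Fin l → Fin R → T,
      (if ∀ i, ¬ Function.Injective (r i) then (1 : ℝ) else 0) =
        ∏ i, if Function.Injective (r i) then (0 : ℝ) else 1 := by
    intro r
    simp only [← ite_not (p := Function.Injective _)]
    rw [Finset.prod_ite_zero]
    simp
  refine (Fintype.expect_equiv (Equiv.piComm fun _ _ => T) _
    (fun r : Fin l → Fin R → T => if ∀ i, ¬ Function.Injective (r i) then (1 : ℝ) else 0)
    fun r => rfl).trans_le ?_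
  simp only [hprod]
  rw [Fintype.expect_eq_sum_div_card, ← Fintype.sum_pow (fun f : Fin R → T =>
    if Function.Injective f then (0 : ℝ) else 1) l, Fintype.card_fun, Fintype.card_fin,
    Nat.cast_pow, ← div_pow, ← Fintype.expect_eq_sum_div_card]
  refine pow_le_pow_left₀ (Finset.expect_nonneg fun f _ => ?_) (expect_not_injective_le R h) l
  split_ifs <;> norm_num

end Birthday

/-! ### The advantage at a fixed security parameter -/

section Advantage

open scoped BigOperators

variable {K d n l q : ℕ}

theorem preparable_genState (G : QCircuit (Fin K ⊕ Fin d) (Fin n)) (k : Fin K → Bool)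
    (x : Fin d → Bool) : Preparable (genState G k x) (7 * G.size) := by
  refine ((preparable_basisState _).run G).mono ?_
  simp only [QCircuit.size, Fintype.card_sum, Fintype.card_fin]
  omega

theorem isState_shareState (G : QCircuit (Fin K ⊕ Fin d) (Fin n)) (k : Fin l → Fin K → Bool)
    (r : Fin l → Fin (d - 1) → Bool) (s : Fin l → Bool) : IsState (shareState G k r s) :=
  (preparable_tensorPi _ _ fun i =>
    (preparable_basisState (r i)).tensor (preparable_genState G (k i) _)).isState

/-- Encryption of `m` with given tags `r`. -/
noncomputable def tagEnc (G : QCircuit (Fin K ⊕ Fin d) (Fin n)) (k : Fin l → Fin K → Bool)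
    (r : Fin l → Fin (d - 1) → Bool) (m : Bool) : Op (Fin l × (Fin (d - 1) ⊕ Fin n)) :=
  ((Finset.univ.filter fun s : Fin l → Bool => xorAll s = m).card : ℂ)⁻¹ •
    ∑ s ∈ Finset.univ.filter (fun s : Fin l → Bool => xorAll s = m), shareState G k r s

theorem shareEnc_eq (G : QCircuit (Fin K ⊕ Fin d) (Fin n)) (k : Fin l → Fin K → Bool) (m : Bool) :
    shareEnc G k m = (Fintype.card (Fin l → Fin (d - 1) → Bool) : ℂ)⁻¹ •
      ∑ r, tagEnc G k r m := by
  simp only [shareEnc, tagEnc, ← Finset.smul_sum]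
  rw [smul_comm, Finset.sum_comm]

theorem isState_tagEnc (hl : 0 < l) (G : QCircuit (Fin K ⊕ Fin d) (Fin n))
    (k : Fin l → Fin K → Bool) (r : Fin l → Fin (d - 1) → Bool) (m : Bool) :
    IsState (tagEnc G k r m) :=
  isState_average _ (filter_xorAll_nonempty hl m) _ fun _ _ => isState_shareState _ _ _ _

theorem tagEnc_eq_average (i0 : Fin l) (G : QCircuit (Fin K ⊕ Fin d) (Fin n))
    (k : Fin l → Fin K → Bool) (r : Fin l → Fin (d - 1) → Bool) (m : Bool) :
    tagEnc G k r m = (Fintype.card (Fin l → Bool) : ℂ)⁻¹ •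
      ∑ s, shareState G k r (fixShare i0 s m) :=
  average_filter_xorAll i0 m _

theorem shareState_update_fixShare (i0 : Fin l) (G : QCircuit (Fin K ⊕ Fin d) (Fin n))
    (k : Fin l → Fin K → Bool) (y : Fin K → Bool) (r : Fin l → Fin (d - 1) → Bool)
    (s : Fin l → Bool) (m : Bool) :
    shareState G (Function.update k i0 y) r (fixShare i0 s m) =
      plugState i0 r (fun i => genState G (k i) (appendBit (r i) (s i)))
        (genState G y (appendBit (r i0) (xor m (xor (s i0) (xorAll s))))) := by
  rw [shareState, plugState]
  congr 1
  funext i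
  by_cases hi : i = i0
  · subst hi
    simp [fixShare]
  · simp [fixShare, hi]

/-- The acceptance probability with challenge bit `b`, for given tags, shares (up to the correction
of the shares with index `i0`), and keys, where `y` is the key with index `i0`. -/
noncomputable def CPAAdversary.hybrid (A : CPAAdversary (Fin l × (Fin (d - 1) ⊕ Fin n)) q)
    (G : QCircuit (Fin K ⊕ Fin d) (Fin n)) (i0 : Fin l)
    (r : Fin A.rounds → Fin l → Fin (d - 1) → Bool) (s : Fin A.rounds → Fin l → Bool)
    (k : Fin l → Fin K → Bool) (b : Bool) (y : Fin K → Bool) : ℝ :=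
  A.accept fun j m => plugState i0 (r j) (fun i => genState G (k i) (appendBit (r j i) (s j i)))
    (genState G y (appendBit (r j i0) (xor (m b) (xor (s j i0) (xorAll (s j))))))

/-- Since all shares but one, and all keys but one, may be sampled before the remaining ones, the
average over keys is an average of hybrids. -/
theorem CPAAdversary.expect_accept_tagEnc (A : CPAAdversary (Fin l × (Fin (d - 1) ⊕ Fin n)) q)
    (G : QCircuit (Fin K ⊕ Fin d) (Fin n)) (i0 : Fin l)
    (r : Fin A.rounds → Fin l → Fin (d - 1) → Bool) (b : Bool) :
    𝔼 k : Fin l → Fin K → Bool, A.accept (fun j m => tagEnc G k (r j) (m b)) =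
      𝔼 k : Fin l → Fin K → Bool, 𝔼 s : Fin A.rounds → Fin l → Bool,
        𝔼 y, A.hybrid G i0 r s k b y := by
  rw [expect_eq_expect_update i0]
  refine Finset.expect_congr rfl fun k _ => ?_
  rw [Finset.expect_comm]
  refine Finset.expect_congr rfl fun y _ => ?_
  simp only [tagEnc_eq_average i0, hybrid, ← shareState_update_fixShare]
  exact A.accept_average fun j s m => shareState G (Function.update k i0 y) (r j)
    (fixShare i0 s (m b))

theorem appendBit_injective (hd : 1 ≤ d) {r r' : Fin (d - 1) → Bool} {s s' : Bool}
    (h : (appendBit r s : Fin d → Bool) = appendBit r' s') : r = r' ∧ s = s' := by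
  constructor
  · funext i
    have := congrFun h ⟨i.1, by omega⟩
    simpa [appendBit] using this
  · have := congrFun h ⟨d - 1, by omega⟩
    simpa [appendBit] using this

/-- If the tags with index `i0` do not collide, then the two challenge bits are distinguished only
as well as the generator is distinguished from Haar-random states. -/
theorem CPAAdversary.exists_distinguisher_hybrid (hd : 1 ≤ d)
    (A : CPAAdversary (Fin l × (Fin (d - 1) ⊕ Fin n)) q)
    (G : QCircuit (Fin K ⊕ Fin d) (Fin n)) (i0 : Fin l)
    (r : Fin A.rounds → Fin l → Fin (d - 1) → Bool) (hr : Function.Injective fun j => r j i0)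
    (s : Fin A.rounds → Fin l → Bool) (k : Fin l → Fin K → Bool) :
    ∃ x : Fin (A.rounds * 2) → Fin d → Bool, Function.Injective x ∧
    ∃ B : Bool → QCircuit (Fin (A.rounds * 2) × (Fin d ⊕ Fin 1 × Fin n)) Unit,
      (∀ b, (B b).size ≤ A.rounds * 2 * (d + n) + 2 * A.size +
        A.rounds * (39 * (d + n) + (7 * (d - 1) + l * (7 * (d - 1) + 7 * G.size)))) ∧
      |(𝔼 y, A.hybrid G i0 r s k false y) - 𝔼 y, A.hybrid G i0 r s k true y| ≤
        ∑ b, |prfsReal G x (B b) - prfsIdeal x (B b)| := by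
  let idx : Fin A.rounds × Bool ≃ Fin (A.rounds * 2) :=
    ((Equiv.refl _).prodCongr finTwoEquiv.symm).trans finProdFinEquiv
  let x : Fin (A.rounds * 2) → Fin d → Bool := fun p =>
    appendBit (r (idx.symm p).1 i0) (idx.symm p).2
  let other : Fin A.rounds → Fin l → Op (Fin n) := fun j i =>
    genState G (k i) (appendBit (r j i) (s j i))
  let c : Fin A.rounds → Bool := fun j => xor (s j i0) (xorAll (s j))
  have hx : Function.Injective x := by
    intro p p' h
    obtain ⟨h1, h2⟩ := appendBit_injective hd h
    exact idx.symm.injective (Prod.ext (hr h1) h2)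
  choose B hsize hB using fun b => A.exists_distinguisher b i0 r other c (7 * G.size)
    (fun j i => preparable_genState G _ _) idx x
  have hreal : ∀ b, prfsReal G x (B b) = 𝔼 y, A.hybrid G i0 r s k b y := by
    intro b
    rw [prfsReal, Fintype.expect_eq_sum_div_card]
    congr 1
    · refine Finset.sum_congr rfl fun y _ => ?_
      rw [hB b _ fun p => (preparable_genState G y _).isState.2]
      simp only [CPAAdversary.hybrid, x, Equiv.symm_apply_apply]
      rfl
    · simp
  have hideal : prfsIdeal x (B false) = prfsIdeal x (B true) := by
    have h : ∀ b, prfsIdeal x (B b) = ∫ psi : Fin (A.rounds * 2) →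
        Metric.sphere (0 : EuclideanSpace ℂ (Fin n → Bool)) 1,
        A.accept (fun j m => plugState i0 (r j) (other j)
          (pureState fun a => (psi (idx (j, xor (m b) (c j)))).1 a))
        ∂(Measure.pi fun _ => haarState n) := by
      intro b
      rw [prfsIdeal]
      congr 1
      funext psi
      exact hB b _ fun p => trace_pureState_sphere _
    rw [h, h]
    refine A.integral_accept_eq (haarState n) idx c (fun j psi => plugState i0 (r j) (other j)
      (pureState fun a => psi.1 a)) fun j => continuous_tensorPi fun i => ?_
    refine continuous_tensor continuous_const ?_
    by_cases hi : i = i0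
    · subst hi
      simpa using continuous_pureState
    · simpa [hi] using continuous_const
  refine ⟨x, hx, B, hsize, ?_⟩
  rw [← hreal, ← hreal, Fintype.sum_bool, hideal]
  have := abs_sub_le (prfsReal G x (B false)) (prfsIdeal x (B true)) (prfsReal G x (B true))
  rw [abs_sub_comm (prfsIdeal x (B true))] at this
  linarith

theorem CPAAdversary.accept_tagEnc_mem_Icc (hl : 0 < l)
    (A : CPAAdversary (Fin l × (Fin (d - 1) ⊕ Fin n)) q)
    (G : QCircuit (Fin K ⊕ Fin d) (Fin n)) (r : Fin A.rounds → Fin l → Fin (d - 1) → Bool)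
    (k : Fin l → Fin K → Bool) (b : Bool) :
    A.accept (fun j m => tagEnc G k (r j) (m b)) ∈ Set.Icc (0 : ℝ) 1 := by
  let r' : ℕ → Fin l → Fin (d - 1) → Bool := fun j =>
    if h : j < A.rounds then r ⟨j, h⟩ else fun _ _ => false
  have h := A.outputProb_play fun j m => tagEnc G k (r' j) (m b)
  simp only [r', Fin.is_lt, dif_pos, Fin.eta] at h
  rw [← h]
  exact QCircuit.outputProb_mem_Icc _ (A.isState_play (fun _ _ => isState_tagEnc hl _ _ _ _) _) _

/-- The advantage is bounded by the probability that there is no index without a collision of tags,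
and by the advantage of the best distinguisher for tags with such an index. -/
theorem CPAAdversary.exists_distinguishers (hd : 1 ≤ d) (hq : q * q ≤ 2 ^ (d - 1))
    (A : CPAAdversary (Fin l × (Fin (d - 1) ⊕ Fin n)) q) (G : QCircuit (Fin K ⊕ Fin d) (Fin n)) :
    ∃ s ≤ 2 * q, ∃ x : Fin s → Fin d → Bool, Function.Injective x ∧
    ∃ B : Bool → QCircuit (Fin s × (Fin d ⊕ Fin 1 × Fin n)) Unit,
      (∀ b, (B b).size ≤ 2 * A.size + q * G.size * (89 + 14 * l) + 1) ∧
      (0 < l → |(𝔼 k : Fin l → Fin K → Bool, A.accept fun _ m => shareEnc G k (m false)) -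
          𝔼 k : Fin l → Fin K → Bool, A.accept fun _ m => shareEnc G k (m true)| ≤
        (1 / 2) ^ l + ∑ b, |prfsReal G x (B b) - prfsIdeal x (B b)|) := by
  classical
  let P : Bool → (Fin A.rounds → Fin l → Fin (d - 1) → Bool) → ℝ := fun b r =>
    𝔼 k : Fin l → Fin K → Bool, A.accept fun j m => tagEnc G k (r j) (m b)
  have hP : ∀ b, (𝔼 k : Fin l → Fin K → Bool, A.accept fun _ m => shareEnc G k (m b)) =
      𝔼 r, P b r := by
    intro b
    simp only [P]
    rw [Finset.expect_comm]
    refine Finset.expect_congr rfl fun k _ => ?_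
    simp only [shareEnc_eq]
    exact A.accept_average fun _ r m => tagEnc G k r (m b)
  have hbad : 0 < l → ∀ r, |P false r - P true r| ≤ 1 := by
    intro hl r
    have hmem : ∀ b, 0 ≤ P b r ∧ P b r ≤ 1 := fun b =>
      ⟨Finset.expect_nonneg fun k _ => (A.accept_tagEnc_mem_Icc hl G r k b).1,
        Finset.expect_le Finset.univ_nonempty fun k _ => (A.accept_tagEnc_mem_Icc hl G r k b).2⟩
    rw [abs_le]
    constructor <;> linarith [(hmem false).1, (hmem false).2, (hmem true).1, (hmem true).2]
  have hmain : ∀ δ : ℝ, 0 ≤ δ → (∀ r i0, Function.Injective (fun j => r j i0) →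
      |P false r - P true r| ≤ δ) → 0 < l →
      |(𝔼 k : Fin l → Fin K → Bool, A.accept fun _ m => shareEnc G k (m false)) -
        𝔼 k : Fin l → Fin K → Bool, A.accept fun _ m => shareEnc G k (m true)| ≤
          (1 / 2) ^ l + δ := by
    intro δ hδ hgood hl
    rw [hP, hP, ← Finset.expect_sub_distrib]
    have hcoll := expect_forall_not_injective_le (T := Fin (d - 1) → Bool) A.rounds l (by
      simpa using (Nat.mul_le_mul A.rounds_le A.rounds_le).trans hq)
    calc |𝔼 r, (P false r - P true r)| ≤ 𝔼 r, |P false r - P true r| := Finset.abs_expect_le _ _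
      _ ≤ 𝔼 r : Fin A.rounds → Fin l → Fin (d - 1) → Bool,
          ((if ∀ i, ¬ Function.Injective fun j => r j i then (1 : ℝ) else 0) + δ) := by
        refine Finset.expect_le_expect fun r _ => ?_
        split_ifs with h
        · linarith [hbad hl r]
        · push Not at h
          obtain ⟨i0, hi0⟩ := h
          linarith [hgood r i0 hi0]
      _ ≤ _ := by
        rw [Finset.expect_add_distrib, Fintype.expect_const]
        refine add_le_add (le_of_eq_of_le ?_ hcoll) le_rfl
        congr!
  -- The nonuniform advice: tags with a collision-free index, shares, and keys.
  let Good := {p : (Fin A.rounds → Fin l → Fin (d - 1) → Bool) × Fin l //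
    Function.Injective fun j => p.1 j p.2} × (Fin A.rounds → Fin l → Bool) × (Fin l → Fin K → Bool)
  let D : Good → ℝ := fun g => |(𝔼 y, A.hybrid G g.1.1.2 g.1.1.1 g.2.1 g.2.2 false y) -
    𝔼 y, A.hybrid G g.1.1.2 g.1.1.1 g.2.1 g.2.2 true y|
  have hD : ∀ δ, (∀ g, D g ≤ δ) → ∀ r i0, Function.Injective (fun j => r j i0) →
      |P false r - P true r| ≤ δ := by
    intro δ hδ r i0 hr
    simp only [P]
    rw [A.expect_accept_tagEnc G i0, A.expect_accept_tagEnc G i0, ← Finset.expect_sub_distrib]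
    refine (Finset.abs_expect_le _ _).trans (Finset.expect_le Finset.univ_nonempty fun k _ => ?_)
    rw [← Finset.expect_sub_distrib]
    refine (Finset.abs_expect_le _ _).trans (Finset.expect_le Finset.univ_nonempty fun s _ => ?_)
    exact hδ (⟨(r, i0), hr⟩, s, k)
  -- If no tags have a collision-free index, then any circuits will do, on no inputs at all.
  rcases isEmpty_or_nonempty Good with hE | hN
  · refine ⟨0, by omega, fun p => p.elim0, fun p => p.elim0,
      fun _ => ⟨1, [], ⟨fun _ => .inr 0, fun _ _ _ => rfl⟩⟩, fun b => ?_, fun hl => ?_⟩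
    · simp [QCircuit.size]
    · refine hmain _ (Finset.sum_nonneg fun _ _ => abs_nonneg _) (hD _ fun g => hE.elim g) hl
  · obtain ⟨g, hg⟩ := Finite.exists_max D
    obtain ⟨x, hx, B, hsize, hB⟩ := A.exists_distinguisher_hybrid hd G g.1.1.2 g.1.1.1 g.1.2
      g.2.1 g.2.2
    refine ⟨A.rounds * 2, by have := A.rounds_le; omega, x, hx, B, fun b => (hsize b).trans ?_,
      fun hl => hmain _ (Finset.sum_nonneg fun _ _ => abs_nonneg _)
        (hD _ fun g' => (hg g').trans hB) hl⟩
    have hdn : d + n ≤ 2 * G.size := by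
      have hn := Fintype.card_le_of_embedding G.out
      simp only [Fintype.card_sum, Fintype.card_fin] at hn
      simp only [QCircuit.size, Fintype.card_sum, Fintype.card_fin]
      omega
    have hd1 : d - 1 ≤ G.size := by
      simp only [QCircuit.size, Fintype.card_sum, Fintype.card_fin]
      omega
    calc A.rounds * 2 * (d + n) + 2 * A.size +
        A.rounds * (39 * (d + n) + (7 * (d - 1) + l * (7 * (d - 1) + 7 * G.size)))
        ≤ q * 2 * (2 * G.size) + 2 * A.size +
          q * (39 * (2 * G.size) + (7 * G.size + l * (7 * G.size + 7 * G.size))) := by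
          have := A.rounds_le
          gcongr
      _ = 2 * A.size + q * G.size * (89 + 14 * l) := by ring
      _ ≤ _ := Nat.le_succ _

end Advantage

/-! ### Asymptotics and sizes -/

section Asymptotics

theorem PolyBounded.mono {f g : ℕ → ℕ} (hg : PolyBounded g) (h : ∀ lam, f lam ≤ g lam) :
    PolyBounded f :=
  hg.imp fun _ hp lam => (h lam).trans (hp lam)

theorem PolyBounded.add {f g : ℕ → ℕ} (hf : PolyBounded f) (hg : PolyBounded g) :
    PolyBounded fun lam => f lam + g lam := by
  obtain ⟨p, hp⟩ := hf
  obtain ⟨r, hr⟩ := hg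
  exact ⟨p + r, fun lam => by simpa using add_le_add (hp lam) (hr lam)⟩

theorem PolyBounded.mul {f g : ℕ → ℕ} (hf : PolyBounded f) (hg : PolyBounded g) :
    PolyBounded fun lam => f lam * g lam := by
  obtain ⟨p, hp⟩ := hf
  obtain ⟨r, hr⟩ := hg
  exact ⟨p * r, fun lam => by simpa using Nat.mul_le_mul (hp lam) (hr lam)⟩

theorem polyBounded_const (c : ℕ) : PolyBounded fun _ => c := ⟨Polynomial.C c, fun _ => by simp⟩

theorem polyBounded_id : PolyBounded fun lam => lam := ⟨Polynomial.X, fun _ => by simp⟩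

theorem negligible_half_pow : Negligible fun lam => (1 / 2 : ℝ) ^ lam := fun c =>
  tendsto_pow_const_mul_const_pow_of_abs_lt_one c (by rw [abs_lt]; norm_num)

theorem Negligible.mono {f g : ℕ → ℝ} (hg : Negligible g) (h : ∀ lam, 0 < lam → |f lam| ≤ g lam) :
    Negligible f := by
  intro c
  refine squeeze_zero_norm' ?_ (hg c)
  filter_upwards [eventually_gt_atTop 0] with lam hlam
  rw [Real.norm_eq_abs, abs_mul, abs_of_nonneg (by positivity : (0 : ℝ) ≤ (lam : ℝ) ^ c)]
  exact mul_le_mul_of_nonneg_left (h lam hlam) (by positivity)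

end Asymptotics

section Construction

open scoped BigOperators

variable (d : ℕ → ℕ → ℕ) (n : ℕ → ℕ)
  (G : ∀ lam q, QCircuit (Fin lam ⊕ Fin (d lam q)) (Fin (n lam)))
  (Test : ∀ lam q, QCircuit ((Fin lam ⊕ Fin (d lam q)) ⊕ Fin (n lam)) Unit)

theorem prfsQSKE_cpaProb (lam q : ℕ)
    (A : CPAAdversary (Fin lam × (Fin (d lam q - 1) ⊕ Fin (n lam))) q) (b : Bool) :
    (prfsQSKE d n G Test).cpaProb lam q A b =
      𝔼 k : Fin lam → Fin lam → Bool, A.accept fun _ m => shareEnc (G lam q) k (m b) := by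
  have h : (prfsQSKE d n G Test).cpaProb lam q A b =
      ∑ sk : Fin lam × Fin lam → Bool,
        (PMF.uniformOfFintype (Fin lam × Fin lam → Bool) sk).toReal *
          A.guess.outputProb (A.state (shareEnc (G lam q) fun i a => sk (i, a)) b A.rounds) true :=
    rfl
  rw [h, ← Fintype.expect_equiv (Equiv.curry (Fin lam) (Fin lam) Bool)
    (fun sk => A.accept fun _ m => shareEnc (G lam q) (fun i a => sk (i, a)) (m b))
    (fun k => A.accept fun _ m => shareEnc (G lam q) k (m b)) fun _ => rfl,
    Fintype.expect_eq_sum_div_card, Finset.sum_div]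
  refine Finset.sum_congr rfl fun sk _ => ?_
  rw [PMF.uniformOfFintype_apply, CPAAdversary.state_eq_play, CPAAdversary.outputProb_play,
    ENNReal.toReal_inv, ENNReal.toReal_natCast, inv_mul_eq_div]

theorem sq_le_two_pow_of_logb {q d : ℕ} (h : 2 * Real.logb 2 q + 1 ≤ d) :
    1 ≤ d ∧ q * q ≤ 2 ^ (d - 1) := by
  have hlog : 0 ≤ Real.logb 2 q := by
    rcases Nat.eq_zero_or_pos q with rfl | hq
    · simp
    · exact Real.logb_nonneg (by norm_num) (by exact_mod_cast hq)
  have hd : 1 ≤ d := by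
    have : (1 : ℝ) ≤ d := by linarith
    exact_mod_cast this
  refine ⟨hd, ?_⟩
  rcases Nat.eq_zero_or_pos q with rfl | hq
  · simp
  · have hq' : (0 : ℝ) < q := by exact_mod_cast hq
    have h1 : Real.logb 2 ((q : ℝ) * q) ≤ ((d - 1 : ℕ) : ℝ) := by
      rw [Real.logb_mul hq'.ne' hq'.ne', Nat.cast_sub hd]
      push_cast
      linarith
    rw [Real.logb_le_iff_le_rpow (by norm_num) (by positivity), Real.rpow_natCast] at h1
    exact_mod_cast h1

theorem prfsQSKE_cpaSecure (q : ℕ → ℕ) (hq : PolyBounded q)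
    (hd : ∀ lam, 2 * Real.logb 2 (q lam) + 1 ≤ d lam (q lam))
    (hG : SelectivelySecurePRFS (fun lam => d lam (q lam)) n fun lam => G lam (q lam)) :
    (prfsQSKE d n G Test).CPASecure q := by
  intro A hA
  obtain ⟨hGsize, hGsec⟩ := hG
  have key := fun lam => CPAAdversary.exists_distinguishers (sq_le_two_pow_of_logb (hd lam)).1
    (sq_le_two_pow_of_logb (hd lam)).2 (A lam) (G lam (q lam))
  choose s hs x hx B hsize hB using key
  have hspoly : PolyBounded s := ((polyBounded_const 2).mul hq).mono hs
  have hBpoly : ∀ b, PolyBounded fun lam => (B lam b).size := fun b =>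
    ((((polyBounded_const 2).mul hA).add ((hq.mul hGsize).mul ((polyBounded_const 89).add
      ((polyBounded_const 14).mul polyBounded_id)))).add (polyBounded_const 1)).mono
      fun lam => hsize lam b
  have hneg := fun b => hGsec s (fun _ => 1) hspoly (polyBounded_const 1) (fun lam => B lam b)
    (hBpoly b) x hx
  have hsum : Negligible fun lam => (1 / 2 : ℝ) ^ lam +
      (|prfsReal (G lam (q lam)) (x lam) (B lam true) - prfsIdeal (x lam) (B lam true)| +
        |prfsReal (G lam (q lam)) (x lam) (B lam false) - prfsIdeal (x lam) (B lam false)|) :=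
    Asymptotics.SuperpolynomialDecay.add negligible_half_pow
      (Asymptotics.SuperpolynomialDecay.add (hneg true) (hneg false))
  refine hsum.mono fun lam hlam => ?_
  rw [abs_abs]
  have h := hB lam hlam
  rw [Fintype.sum_bool] at h
  rw [← prfsQSKE_cpaProb d n G Test lam (q lam) (A lam) false,
    ← prfsQSKE_cpaProb d n G Test lam (q lam) (A lam) true] at h
  exact h

theorem prfsQSKE_keySize (lam q : ℕ) : (prfsQSKE d n G Test).keySize lam q = lam * lam := by
  have h : (prfsQSKE d n G Test).keySize lam q = Fintype.card (Fin lam × Fin lam) := rfl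
  simp [h]

theorem prfsQSKE_ctSize (lam q : ℕ) :
    (prfsQSKE d n G Test).ctSize lam q = lam * (d lam q - 1 + n lam) := by
  have h : (prfsQSKE d n G Test).ctSize lam q =
    Fintype.card (Fin lam × (Fin (d lam q - 1) ⊕ Fin (n lam))) := rfl
  simp [h]

theorem polyLogBounded_ctSize (hn : PolyBounded n) (hd : PolyLogBounded d) :
    PolyLogBounded (prfsQSKE d n G Test).ctSize := by
  obtain ⟨p, hp⟩ := hn
  obtain ⟨r, hr⟩ := hd
  refine ⟨MvPolynomial.X 0 * (r + Polynomial.aeval (MvPolynomial.X 0) p), fun lam q => ?_⟩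
  have h : MvPolynomial.eval ![lam, Nat.clog 2 q]
      (Polynomial.aeval (MvPolynomial.X (0 : Fin 2)) p : MvPolynomial (Fin 2) ℕ) = p.eval lam := by
    rw [Polynomial.aeval_def, Polynomial.hom_eval₂, Subsingleton.elim (RingHom.comp _ _)
      (RingHom.id ℕ), MvPolynomial.eval_X]
    rfl
  rw [prfsQSKE_ctSize]
  simp only [map_mul, map_add, MvPolynomial.eval_X, h, Matrix.cons_val_zero]
  exact Nat.mul_le_mul_left _ (add_le_add ((Nat.sub_le _ _).trans (hr lam q)) (hp lam))

theorem polyLogBounded_ceil_logb (hd : ∀ lam q : ℕ, d lam q = ⌈2 * Real.logb 2 q⌉₊ + 1) :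
    PolyLogBounded d := by
  refine ⟨MvPolynomial.C 2 * MvPolynomial.X 1 + 1, fun lam q => ?_⟩
  rw [hd]
  simp only [map_add, map_mul, MvPolynomial.eval_C, MvPolynomial.eval_X, map_one,
    Matrix.cons_val_one, Matrix.cons_val_fin_one]
  gcongr
  rw [Nat.ceil_le]
  push_cast
  gcongr
  rcases Nat.eq_zero_or_pos q with rfl | hq
  · simp
  · rw [Real.logb_le_iff_le_rpow (by norm_num) (by exact_mod_cast hq), Real.rpow_natCast]
    exact_mod_cast Nat.le_pow_clog (by norm_num) q

end Construction

theorem mainTheorem5 (d : ℕ → ℕ → ℕ) (n : ℕ → ℕ)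
    (G : ∀ lam q, QCircuit (Fin lam ⊕ Fin (d lam q)) (Fin (n lam)))
    (Test : ∀ lam q, QCircuit ((Fin lam ⊕ Fin (d lam q)) ⊕ Fin (n lam)) Unit) :
    -- CPA security for up to `q` queries, for every polynomial `q`
    (∀ q : ℕ → ℕ, PolyBounded q →
      (∀ lam, 2 * Real.logb 2 (q lam) + 1 ≤ d lam (q lam)) →
      SelectivelySecurePRFS (fun lam => d lam (q lam)) n (fun lam => G lam (q lam)) →
      (prfsQSKE d n G Test).CPASecure q) ∧
    -- keys of size `poly(lam)`, whatever the query bound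
    (∃ p : Polynomial ℕ, ∀ lam q, (prfsQSKE d n G Test).keySize lam q ≤ p.eval lam) ∧
    -- ciphertexts of size `poly(lam, log q)`
    (PolyBounded n → PolyLogBounded d → PolyLogBounded (prfsQSKE d n G Test).ctSize) ∧
    -- in particular for the least admissible input length of the generator
    (PolyBounded n → (∀ lam q : ℕ, d lam q = ⌈2 * Real.logb 2 q⌉₊ + 1) →
      PolyLogBounded (prfsQSKE d n G Test).ctSize) := by
  refine ⟨fun q hq hd hG => prfsQSKE_cpaSecure d n G Test q hq hd hG,
    ⟨Polynomial.X * Polynomial.X, fun lam q => ?_⟩,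
    fun hn hd => polyLogBounded_ctSize d n G Test hn hd,
    fun hn hd => polyLogBounded_ctSize d n G Test hn (polyLogBounded_ceil_logb d hd)⟩
  rw [prfsQSKE_keySize]
  simp
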